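/- Let $G$ be a discrete group. A compact $G$-space is a nonempty compact Hausdorff space on which $G$ acts by homeomorphisms; $G$ acts on $C(X)=C(X,\mathbb{C})$ by $(sf)(x)=f(s^{-1}x)$. It is minimal if every orbit is dense, strongly proximal if for every regular Borel probability measure $\nu$ on $X$ the weak* closure of $G\nu$ contains a point mass, and a $G$-boundary if it is minimal and strongly proximal. A Furstenberg boundary $\partial_F G$ of $G$ is a $G$-boundary of which every $G$-boundary is a continuous $G$-equivariant image. An operator system is a unital self-adjoint subspace of a nonzero unital C*-algebra; a $G$-operator system is an operator system with an action of $G$ by linear order isomorphisms. All maps between operator systems are linear. A $G$-operator system $\mathcal U$ is $G$-injective if for all $G$-operator systems $\mathcal S,\mathcal T$, every unital completely isometric $G$-equivariant map $\iota:\mathcal S\to\mathcal T$ and every unital completely positive $G$-equivariant map $\psi:\mathcal S\to\mathcal U$, there is a unital completely positive $G$-equivariant map $\hat\psi:\mathcal T\to\mathcal U$ with $\hat\psi\iota=\psi$; injectivity of an operator system is the same property without group actions. **Theorem.** The group $G$ has a Furstenberg boundary. For every Furstenberg boundary $\partial_F G$ of $G$, the algebra $C(\partial_F G)$ is $G$-injective,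 and it is injective. Moreover: 1. Every unital positive $G$-equivariant map from $C(\partial_F G)$ into a $G$-operator system $\mathcal S$ is completely isometric. 2. The only unital positive $G$-equivariant map from $C(\partial_F G)$ to itself is the identity map. 3. If $B$ is a $G$-boundary, then there is a unique unital positive $G$-equivariant map from $C(B)$ to $C(\partial_F G)$, and it is a unital injective *-homomorphism. 4. If $M$ is a minimal compact $G$-space, then there is at most one unital positive $G$-equivariant map from $C(\partial_F G)$ to $C(M)$, and if such a map exists, then it is a unital injective *-homomorphism. -/

import Mathlib

open scoped ComplexOrder

universe u v w₁ w₂ w₃ w₄ w₅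

/-! ### Compact `G`-spaces and boundaries -/

/-- The `G`-action on `X` is strongly proximal: for every regular Borel probability measure `ν`
on `X`, the weak* closure of the orbit `G ν` contains a point mass. -/
def IsStronglyProximal (G : Type*) [Group G] (X : Type*) [TopologicalSpace X] [MulAction G X]
    [ContinuousConstSMul G X] : Prop :=
  letI : MeasurableSpace X := borel X
  haveI : BorelSpace X := ⟨rfl⟩
  ∀ ν : MeasureTheory.ProbabilityMeasure X, (ν : MeasureTheory.Measure X).Regular →
    ∃ x : X, MeasureTheory.diracProba x ∈
      closure (Set.range fun s : G =>
        ν.map ((continuous_const_smul s : Continuous fun y : X => s • y).measurable.aemeasurable))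

/-- A `G`-boundary: a nonempty compact Hausdorff `G`-space on which the action is minimal and
strongly proximal. -/
structure IsGBoundary (G : Type*) [Group G] (X : Type*) [TopologicalSpace X] [MulAction G X]
    [ContinuousConstSMul G X] : Prop where
  nonempty : Nonempty X
  compact : CompactSpace X
  t2 : T2Space X
  minimal : MulAction.IsMinimal G X
  stronglyProximal : IsStronglyProximal G X

/-- `X` is the Furstenberg boundary of `G`: it is a `G`-boundary, and every `G`-boundary is a
continuous `G`-equivariant image of it. Every `G`-boundary is a quotient of the Stone-Čech
compactification of `G`, so up to isomorphism all of them occur in the universe of `G`. -/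
structure IsFurstenbergBoundary (G : Type u) [Group G] (X : Type v) [TopologicalSpace X]
    [MulAction G X] [ContinuousConstSMul G X] : Prop where
  isGBoundary : IsGBoundary G X
  universal : ∀ (B : Type u) [TopologicalSpace B] [MulAction G B] [ContinuousConstSMul G B],
    IsGBoundary G B →
      ∃ f : X → B, Continuous f ∧ Function.Surjective f ∧ ∀ (s : G) (x : X), f (s • x) = s • f x

/-- The action of `G` on functions, `(s f)(x) = f (s⁻¹ x)`. -/
noncomputable def translateFun {G : Type*} [Group G] {X : Type*} [TopologicalSpace X] [MulAction G X]
    [ContinuousConstSMul G X] (s : G) (f : C(X, ℂ)) : C(X, ℂ) :=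
  ⟨fun x => f (s⁻¹ • x), f.continuous.comp (continuous_const_smul s⁻¹)⟩

/-! ### Operator systems -/

/-- An operator system: a unital self-adjoint subspace of a unital C*-algebra `A`. -/
structure OperatorSystem (A : Type*) [CStarAlgebra A] extends Submodule ℂ A where
  one_mem' : (1 : A) ∈ carrier
  star_mem' : ∀ {a : A}, a ∈ carrier → star a ∈ carrier

namespace OperatorSystem

variable {A B : Type*} [CStarAlgebra A] [CStarAlgebra B]

/-- The underlying vector space of an operator system. -/
abbrev Space (S : OperatorSystem A) : Type _ := S.toSubmodule

/-- The unit of an operator system. -/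
def unit (S : OperatorSystem A) : S.Space := ⟨1, S.one_mem'⟩

/-- A matrix over the operator system `S ⊆ A`, seen in the C*-algebra of matrices over `A`. -/
def toCStarMatrix (S : OperatorSystem A) {n : ℕ} (M : Matrix (Fin n) (Fin n) S.Space) :
    CStarMatrix (Fin n) (Fin n) A :=
  CStarMatrix.ofMatrix (M.map fun x => (x : A))

/-- The linear map `φ` sends the unit to the unit. -/
def IsUnital {S : OperatorSystem A} {T : OperatorSystem B} (φ : S.Space →ₗ[ℂ] T.Space) : Prop :=
  φ S.unit = T.unit

/-- The linear map `φ` is positive. -/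
def IsPositive [PartialOrder A] [PartialOrder B] {S : OperatorSystem A} {T : OperatorSystem B}
    (φ : S.Space →ₗ[ℂ] T.Space) : Prop :=
  ∀ x : S.Space, 0 ≤ (x : A) → 0 ≤ (φ x : B)

/-- The linear map `φ` is completely positive. -/
def IsCompletelyPositive [PartialOrder A] [StarOrderedRing A] [PartialOrder B] [StarOrderedRing B]
    {S : OperatorSystem A} {T : OperatorSystem B} (φ : S.Space →ₗ[ℂ] T.Space) : Prop :=
  ∀ (n : ℕ) (M : Matrix (Fin n) (Fin n) S.Space),
    0 ≤ S.toCStarMatrix M → 0 ≤ T.toCStarMatrix (M.map φ)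

/-- The linear map `φ` is completely isometric. -/
def IsCompletelyIsometric [PartialOrder A] [StarOrderedRing A] [PartialOrder B]
    [StarOrderedRing B] {S : OperatorSystem A} {T : OperatorSystem B}
    (φ : S.Space →ₗ[ℂ] T.Space) : Prop :=
  ∀ (n : ℕ) (M : Matrix (Fin n) (Fin n) S.Space),
    ‖T.toCStarMatrix (M.map φ)‖ = ‖S.toCStarMatrix M‖

/-- Injectivity in the category of operator systems and unital completely positive maps. -/
def IsInjective {D : Type u} [CStarAlgebra D] [PartialOrder D] [StarOrderedRing D]
    (U : OperatorSystem D) : Prop :=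
  ∀ (A : Type w₁) [CStarAlgebra A] [PartialOrder A] [StarOrderedRing A]
    (B : Type w₂) [CStarAlgebra B] [PartialOrder B] [StarOrderedRing B]
    (S : OperatorSystem A) (T : OperatorSystem B)
    (ι : S.Space →ₗ[ℂ] T.Space) (ψ : S.Space →ₗ[ℂ] U.Space),
    IsUnital ι → IsCompletelyIsometric ι → IsUnital ψ → IsCompletelyPositive ψ →
      ∃ ψ' : T.Space →ₗ[ℂ] U.Space,
        IsUnital ψ' ∧ IsCompletelyPositive ψ' ∧ ψ' ∘ₗ ι = ψ

end OperatorSystem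

/-- A `G`-operator system: an operator system with an action of `G` by linear order isomorphisms
(each `s` acts by a positive map with positive inverse, the action of `s⁻¹`). -/
structure GOperatorSystem (G : Type*) [Group G] (A : Type*) [CStarAlgebra A] [PartialOrder A]
    extends OperatorSystem A where
  act : Representation ℂ G toSubmodule
  act_nonneg : ∀ (s : G) (x : toSubmodule), 0 ≤ (x : A) → 0 ≤ (act s x : A)

namespace GOperatorSystem

open OperatorSystem

variable {G : Type*} [Group G] {A B : Type*} [CStarAlgebra A] [PartialOrder A]
  [CStarAlgebra B] [PartialOrder B]

/-- The linear map `φ` commutes with the `G`-actions. -/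
def IsEquivariant {S : GOperatorSystem G A} {T : GOperatorSystem G B}
    (φ : S.Space →ₗ[ℂ] T.Space) : Prop :=
  ∀ (s : G) (x : S.Space), φ (S.act s x) = T.act s (φ x)

/-- `G`-injectivity of a `G`-operator system. -/
def IsGInjective {G : Type u} [Group G] {D : Type v} [CStarAlgebra D]
    [PartialOrder D] [StarOrderedRing D] (U : GOperatorSystem G D) : Prop :=
  ∀ (A : Type w₁) [CStarAlgebra A] [PartialOrder A] [StarOrderedRing A]
    (B : Type w₂) [CStarAlgebra B] [PartialOrder B] [StarOrderedRing B]
    (S : GOperatorSystem G A) (T : GOperatorSystem G B)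
    (ι : S.Space →ₗ[ℂ] T.Space) (ψ : S.Space →ₗ[ℂ] U.Space),
    IsUnital ι → IsCompletelyIsometric ι → IsEquivariant ι →
    IsUnital ψ → IsCompletelyPositive ψ → IsEquivariant ψ →
      ∃ ψ' : T.Space →ₗ[ℂ] U.Space,
        IsUnital ψ' ∧ IsCompletelyPositive ψ' ∧ IsEquivariant ψ' ∧ ψ' ∘ₗ ι = ψ

/-- The algebra `C(X)` of a compact `G`-space `X`, as a `G`-operator system. -/
noncomputable def ofSpace (G : Type*) [Group G] (X : Type*) [TopologicalSpace X] [CompactSpace X]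
    [MulAction G X] [ContinuousConstSMul G X] : GOperatorSystem G C(X, ℂ) where
  toSubmodule := ⊤
  one_mem' := trivial
  star_mem' := fun _ => trivial
  act :=
    { toFun := fun s =>
        { toFun := fun f => ⟨translateFun s f.1, trivial⟩
          map_add' := fun _ _ => rfl
          map_smul' := fun _ _ => rfl }
      map_one' := by
        ext f x
        simp [translateFun]
      map_mul' := fun s t => by
        ext f x
        simp [translateFun, mul_smul] }
  act_nonneg := fun s f hf x => hf (s⁻¹ • x)

end GOperatorSystem

/-! ### Maps between algebras of continuous functions -/

/-- `φ : C(X) → C(Y)` is a unital positive `G`-equivariant linear map. -/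
structure IsUnitalPositiveEquivariant (G : Type*) [Group G] {X Y : Type*}
    [TopologicalSpace X] [MulAction G X] [ContinuousConstSMul G X]
    [TopologicalSpace Y] [MulAction G Y] [ContinuousConstSMul G Y]
    (φ : C(X, ℂ) →ₗ[ℂ] C(Y, ℂ)) : Prop where
  map_one : φ 1 = 1
  map_nonneg : ∀ f : C(X, ℂ), 0 ≤ f → 0 ≤ φ f
  equivariant : ∀ (s : G) (f : C(X, ℂ)), φ (translateFun s f) = translateFun s (φ f)

/-- `φ` is a unital injective *-homomorphism. -/
def IsInjectiveStarHom {X Y : Type*} [TopologicalSpace X] [TopologicalSpace Y]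
    (φ : C(X, ℂ) →ₗ[ℂ] C(Y, ℂ)) : Prop :=
  Function.Injective φ ∧ ∃ Φ : C(X, ℂ) →⋆ₐ[ℂ] C(Y, ℂ), ∀ f, Φ f = φ f

/-!
Glasner: in a minimal compact convex `G`-space every state on the closed orbit of an extreme point
has a barycenter whose orbit accumulates at that extreme point, and an extreme point is
represented only by its point mass; hence this orbit closure is a `G`-boundary. So every compact
convex `G`-space contains a `G`-boundary. Inside the states of `C(βG)`, such a boundary is
universal, and a Furstenberg boundary `X` maps equivariantly into every compact convex `G`-space.

Boundaries are rigid: an equivariant map from a minimal space to the states of `C(X)` takes values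
in the point masses, by strong proximality, and averaging two such maps shows that they coincide.
Consequently an equivariant map from `X` into pairs (state of `T`, state of `C(X)`) that agree on
`S ⊆ T` has evaluation as its second component, and its first component is a positive extension to
`T` of the given map `S → C(X)`. This gives injectivity, and, applied to the identity of `C(X)`, a
positive left inverse of any unital positive equivariant map out of `C(X)`. Positivity upgrades to
complete positivity and complete contractivity because `C(X)` is commutative: into `C(X)` one
tests matrices pointwise on states, and out of `C(X)` one approximates by partitions of unity.
-/

/-! ### Unital positive maps and states -/

/-- The unit of `V` is an order unit, and the norm of a self-adjoint element is at least its order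
unit norm. Operator systems and C*-algebras are instances. -/
class HasNormOrderUnit (V : Type*) [NormedAddCommGroup V] [NormedSpace ℂ V] [StarAddMonoid V]
    [One V] [PartialOrder V] : Prop where
  norm_smul_one_sub_nonneg : ∀ x : V, IsSelfAdjoint x → 0 ≤ (‖x‖ : ℂ) • (1 : V) - x

instance hasNormOrderUnit_of_cstarAlgebra {A : Type*} [CStarAlgebra A] [PartialOrder A]
    [StarOrderedRing A] : HasNormOrderUnit A where
  norm_smul_one_sub_nonneg x hx := by
    simpa [Algebra.algebraMap_eq_smul_one] using hx.le_algebraMap_norm_self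

namespace OperatorSystem

variable {A : Type*} [CStarAlgebra A] (S : OperatorSystem A)

instance : One S.Space := ⟨S.unit⟩

instance : StarAddMonoid S.Space where
  star x := ⟨star (x : A), S.star_mem' x.2⟩
  star_involutive x := Subtype.ext (star_star (x : A))
  star_add x y := Subtype.ext (star_add (x : A) y)

@[simp]
theorem coe_one : ((1 : S.Space) : A) = 1 := rfl

instance : NormedStarGroup S.Space where
  norm_star_le x := (norm_star (x : A)).le

instance : StarModule ℂ S.Space where
  star_smul c x := Subtype.ext (star_smul c (x : A))

instance [PartialOrder A] [StarOrderedRing A] : HasNormOrderUnit S.Space where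
  norm_smul_one_sub_nonneg x hx :=
    HasNormOrderUnit.norm_smul_one_sub_nonneg (x : A) (congrArg Subtype.val hx.star_eq)

end OperatorSystem

/-- A unital positive linear map; with `W = ℂ`, a state of `V`. -/
structure IsUnitalPositive {V W : Type*} [AddCommGroup V] [Module ℂ V] [One V] [PartialOrder V]
    [AddCommGroup W] [Module ℂ W] [One W] [PartialOrder W] (φ : V →ₗ[ℂ] W) : Prop where
  map_one : φ 1 = 1
  map_nonneg : ∀ x : V, 0 ≤ x → 0 ≤ φ x

namespace IsUnitalPositive

theorem comp {U V W : Type*} [AddCommGroup U] [Module ℂ U] [One U] [PartialOrder U]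
    [AddCommGroup V] [Module ℂ V] [One V] [PartialOrder V]
    [AddCommGroup W] [Module ℂ W] [One W] [PartialOrder W]
    {ψ : V →ₗ[ℂ] W} {φ : U →ₗ[ℂ] V} (hψ : IsUnitalPositive ψ) (hφ : IsUnitalPositive φ) :
    IsUnitalPositive (ψ ∘ₗ φ) where
  map_one := by rw [LinearMap.comp_apply, hφ.map_one, hψ.map_one]
  map_nonneg x hx := hψ.map_nonneg _ (hφ.map_nonneg x hx)

variable {V : Type*} [NormedAddCommGroup V] [NormedSpace ℂ V] [StarAddMonoid V] [One V]
  [PartialOrder V] [HasNormOrderUnit V] {L : V →ₗ[ℂ] ℂ}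

theorem le_norm_of_isSelfAdjoint (hL : IsUnitalPositive L) {x : V} (hx : IsSelfAdjoint x) :
    L x ≤ ‖x‖ := by
  simpa [hL.map_one] using hL.map_nonneg _ (HasNormOrderUnit.norm_smul_one_sub_nonneg x hx)

theorem im_eq_zero_of_isSelfAdjoint (hL : IsUnitalPositive L) {x : V} (hx : IsSelfAdjoint x) :
    (L x).im = 0 := by
  simpa using (Complex.le_def.1 (hL.le_norm_of_isSelfAdjoint hx)).2

variable [StarModule ℂ V]

theorem map_star (hL : IsUnitalPositive L) (x : V) : L (star x) = star (L x) := by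
  have re_part := hL.im_eq_zero_of_isSelfAdjoint (IsSelfAdjoint.add_star_self x)
  have im_part : (L (Complex.I • (x - star x))).im = 0 := by
    refine hL.im_eq_zero_of_isSelfAdjoint ?_
    simp [isSelfAdjoint_iff, star_smul, sub_eq_add_neg, add_comm]
  simp only [map_add, map_sub, map_smul, smul_eq_mul, Complex.I_mul_im, Complex.add_im,
    Complex.sub_re] at re_part im_part
  apply Complex.ext
  · simp only [Complex.star_def, Complex.conj_re]
    linarith
  · simp only [Complex.star_def, Complex.conj_im]
    linarith

variable [NormedStarGroup V]

theorem norm_le (hL : IsUnitalPositive L) (x : V) : ‖L x‖ ≤ ‖x‖ := by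
  obtain ⟨c, hc, hcx⟩ := RCLike.exists_norm_eq_mul_self (L x)
  have hself : 2 * ‖L x‖ ≤ ‖c • x + star (c • x)‖ := by
    have hle := hL.le_norm_of_isSelfAdjoint (IsSelfAdjoint.add_star_self (c • x))
    rw [map_add, hL.map_star, map_smul, smul_eq_mul, ← hcx, RCLike.star_def,
      RCLike.conj_ofReal, ← two_mul] at hle
    simpa using (Complex.le_def.1 hle).1
  have hle : ‖c • x + star (c • x)‖ ≤ 2 * ‖x‖ :=
    (norm_add_le _ _).trans_eq (by rw [norm_star, norm_smul, hc]; ring)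
  linarith

end IsUnitalPositive

theorem im_eq_zero_and_re_le_of_norm_add_mul_I_sq_le {z : ℂ} {r : ℝ} (hr : 0 ≤ r)
    (h : ∀ t : ℝ, ‖z + t * Complex.I‖ ^ 2 ≤ r ^ 2 + t ^ 2) : z.im = 0 ∧ z.re ≤ r := by
  have expand (t : ℝ) : z.re ^ 2 + z.im ^ 2 + 2 * t * z.im ≤ r ^ 2 := by
    have ht := h t
    rw [Complex.sq_norm, Complex.normSq_apply] at ht
    simp only [Complex.add_re, Complex.add_im, Complex.re_ofReal_mul, Complex.im_ofReal_mul,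
      Complex.I_re, Complex.I_im] at ht
    linarith
  constructor
  · by_contra hz
    have := expand ((r ^ 2 + 1) / (2 * z.im))
    have : 2 * ((r ^ 2 + 1) / (2 * z.im)) * z.im = r ^ 2 + 1 := by field_simp
    nlinarith [sq_nonneg z.re, sq_nonneg z.im]
  · exact abs_le_of_sq_le_sq' (by nlinarith [expand 0, sq_nonneg z.im]) hr |>.2

section ContractiveFunctionals

variable {A : Type*} [CStarAlgebra A]

theorem norm_one_le_one : ‖(1 : A)‖ ≤ 1 := by
  nontriviality A
  exact CStarRing.norm_one.le

theorem norm_add_mul_I_smul_one_sq_le {a : A} (ha : IsSelfAdjoint a) (t : ℝ) :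
    ‖a + ((t : ℂ) * Complex.I) • (1 : A)‖ ^ 2 ≤ ‖a‖ ^ 2 + t ^ 2 := by
  have star_mul_self : star (a + ((t : ℂ) * Complex.I) • (1 : A)) *
      (a + ((t : ℂ) * Complex.I) • (1 : A)) = a * a + ((t ^ 2 : ℝ) : ℂ) • (1 : A) := by
    have hI : star ((t : ℂ) * Complex.I) = -(t * Complex.I) := by simp
    rw [star_add, ha.star_eq, star_smul, star_one, hI]
    simp only [mul_add, add_mul, smul_mul_assoc, one_mul, mul_smul_comm, mul_one]
    match_scalars
    · ring
    · ring
    · linear_combination -(t : ℂ) ^ 2 * Complex.I_sq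
  calc ‖a + ((t : ℂ) * Complex.I) • (1 : A)‖ ^ 2
      = ‖a * a + ((t ^ 2 : ℝ) : ℂ) • (1 : A)‖ := by
        rw [pow_two, ← CStarRing.norm_star_mul_self, star_mul_self]
    _ ≤ ‖a‖ * ‖a‖ + ‖((t ^ 2 : ℝ) : ℂ)‖ * ‖(1 : A)‖ :=
        (norm_add_le _ _).trans (add_le_add (norm_mul_le _ _) (norm_smul _ _).le)
    _ ≤ ‖a‖ ^ 2 + t ^ 2 := by
        rw [Complex.norm_real, Real.norm_of_nonneg (sq_nonneg t), ← pow_two]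
        gcongr
        exact mul_le_of_le_one_right (sq_nonneg t) norm_one_le_one

variable [PartialOrder A] [StarOrderedRing A]

theorem IsUnitalPositive.of_norm_le {L : A →ₗ[ℂ] ℂ} (hone : L 1 = 1)
    (hnorm : ∀ a, ‖L a‖ ≤ ‖a‖) : IsUnitalPositive L where
  map_one := hone
  map_nonneg a ha := by
    have hsa : IsSelfAdjoint a := .of_nonneg ha
    set b : A := (‖a‖ : ℂ) • 1 - a with hb
    have hb0 : 0 ≤ b := HasNormOrderUnit.norm_smul_one_sub_nonneg a hsa
    have hba : ‖b‖ ≤ ‖a‖ := by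
      rw [CStarAlgebra.norm_le_iff_le_algebraMap _ (norm_nonneg a) hb0]
      simpa [hb, Algebra.algebraMap_eq_smul_one] using ha
    have hLb := im_eq_zero_and_re_le_of_norm_add_mul_I_sq_le (z := L b) (norm_nonneg a)
      fun t => by
        have : L (b + ((t : ℂ) * Complex.I) • (1 : A)) = L b + t * Complex.I := by simp [hone]
        rw [← this]
        calc ‖L (b + ((t : ℂ) * Complex.I) • (1 : A))‖ ^ 2
            ≤ ‖b + ((t : ℂ) * Complex.I) • (1 : A)‖ ^ 2 := by gcongr; exact hnorm _
          _ ≤ ‖b‖ ^ 2 + t ^ 2 := norm_add_mul_I_smul_one_sq_le (.of_nonneg hb0) t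
          _ ≤ ‖a‖ ^ 2 + t ^ 2 := by gcongr
    have hLa : L a = ‖a‖ - L b := by simp [hb, hone]
    rw [hLa, sub_nonneg, Complex.le_def]
    exact ⟨hLb.2, hLb.1⟩

theorem exists_state_extension {V : Type*} [NormedAddCommGroup V] [NormedSpace ℂ V]
    [StarAddMonoid V] [One V] [PartialOrder V] [HasNormOrderUnit V] [StarModule ℂ V]
    [NormedStarGroup V] {T : OperatorSystem A} (ι : V →ₗᵢ[ℂ] T.Space) (hι : ι 1 = 1)
    {L : V →ₗ[ℂ] ℂ} (hL : IsUnitalPositive L) :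
    ∃ L' : T.Space →ₗ[ℂ] ℂ, IsUnitalPositive L' ∧ ∀ x, L' (ι x) = L x := by
  let j : V →ₗᵢ[ℂ] A := T.toSubmodule.subtypeₗᵢ.comp ι
  have hj : j 1 = 1 := congrArg Subtype.val hι
  let f : LinearMap.range j.toLinearMap →ₗ[ℂ] ℂ := L ∘ₗ j.equivRange.symm.toLinearMap
  have hf (y) : ‖f y‖ ≤ 1 * ‖y‖ :=
    (hL.norm_le _).trans_eq (by rw [one_mul]; exact j.equivRange.symm.norm_map y)
  obtain ⟨g, hgf, hg⟩ := exists_extension_norm_eq _ (f.mkContinuous 1 hf)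
  have hgj (x : V) : g (j x) = L x :=
    (hgf (j.equivRange x)).trans (congrArg L (j.equivRange.symm_apply_apply x))
  have hg_state : IsUnitalPositive g.toLinearMap := .of_norm_le
    (by rw [← hj]; exact (hgj 1).trans hL.map_one)
    fun a => g.le_of_opNorm_le (hg.trans_le (f.mkContinuous_norm_le zero_le_one hf)) a |>.trans_eq
      (one_mul _)
  exact ⟨g.toLinearMap ∘ₗ T.toSubmodule.subtype,
    ⟨hg_state.map_one, fun x hx => hg_state.map_nonneg x hx⟩, hgj⟩

end ContractiveFunctionals

/-- The states of `V`, as functions on `V` with the topology of pointwise convergence (the weak*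
topology). -/
def stateSpace (V : Type*) [AddCommGroup V] [Module ℂ V] [One V] [PartialOrder V] : Set (V → ℂ) :=
  {ℓ | ∃ L : V →ₗ[ℂ] ℂ, IsUnitalPositive L ∧ ⇑L = ℓ}

namespace stateSpace

section Algebra

variable {V : Type*} [AddCommGroup V] [Module ℂ V] [One V] [PartialOrder V]

theorem map_one {ℓ : V → ℂ} (hℓ : ℓ ∈ stateSpace V) : ℓ 1 = 1 := by
  obtain ⟨L, hL, rfl⟩ := hℓ
  exact hL.map_one

theorem isClosed : IsClosed (stateSpace V) := by
  have eq_inter : stateSpace V = Set.range ((↑) : (V →ₗ[ℂ] ℂ) → V → ℂ) ∩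
      ({ℓ | ℓ 1 = 1} ∩ ⋂ x ∈ {x : V | 0 ≤ x}, {ℓ | 0 ≤ ℓ x}) := by
    ext ℓ
    constructor
    · rintro ⟨L, hL, rfl⟩
      exact ⟨⟨L, rfl⟩, hL.map_one, Set.mem_iInter₂.2 hL.map_nonneg⟩
    · rintro ⟨⟨L, rfl⟩, hone, hnonneg⟩
      exact ⟨L, ⟨hone, Set.mem_iInter₂.1 hnonneg⟩, rfl⟩
  rw [eq_inter]
  exact (LinearMap.isClosed_range_coe V ℂ _).inter
    ((isClosed_eq (continuous_apply 1) continuous_const).inter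
      (isClosed_biInter fun x _ => isClosed_le continuous_const (continuous_apply x)))

theorem convex : Convex ℝ (stateSpace V) := by
  rintro _ ⟨L, hL, rfl⟩ _ ⟨L', hL', rfl⟩ a b ha hb hab
  refine ⟨a • L + b • L', ⟨?_, fun x hx => ?_⟩, rfl⟩
  · simp [hL.map_one, hL'.map_one, ← Complex.ofReal_add, hab]
  · exact add_nonneg (smul_nonneg ha (hL.map_nonneg x hx)) (smul_nonneg hb (hL'.map_nonneg x hx))

end Algebra

variable {V : Type*} [NormedAddCommGroup V] [NormedSpace ℂ V] [StarAddMonoid V] [One V]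
  [PartialOrder V] [HasNormOrderUnit V] [StarModule ℂ V] [NormedStarGroup V]

theorem norm_apply_le {ℓ : V → ℂ} (hℓ : ℓ ∈ stateSpace V) (x : V) : ‖ℓ x‖ ≤ ‖x‖ := by
  obtain ⟨L, hL, rfl⟩ := hℓ
  exact hL.norm_le x

theorem isCompact : IsCompact (stateSpace V) :=
  (isCompact_univ_pi fun x : V => isCompact_closedBall (0 : ℂ) ‖x‖).of_isClosed_subset isClosed
    fun _ hℓ x _ => mem_closedBall_zero_iff.2 (norm_apply_le hℓ x)

end stateSpace

theorem IsUnitalPositive.precomp_mem_stateSpace {V W : Type*} [AddCommGroup V] [Module ℂ V]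
    [One V] [PartialOrder V] [AddCommGroup W] [Module ℂ W] [One W] [PartialOrder W]
    {φ : V →ₗ[ℂ] W} (hφ : IsUnitalPositive φ) {ℓ : W → ℂ} (hℓ : ℓ ∈ stateSpace W) :
    ℓ ∘ φ ∈ stateSpace V := by
  obtain ⟨L, hL, rfl⟩ := hℓ
  exact ⟨L ∘ₗ φ, hL.comp hφ, rfl⟩

/-! ### Milman's converse to the Krein–Milman theorem -/

section Milman

variable {E : Type*} [AddCommGroup E] [Module ℝ E]

theorem mem_or_mem_of_mem_extremePoints_convexJoin {s t : Set E} (hs : s.Nonempty)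
    (ht : t.Nonempty) {q : E} (hq : q ∈ (convexJoin ℝ s t).extremePoints ℝ) : q ∈ s ∨ q ∈ t := by
  obtain ⟨hq, hq_extreme⟩ := mem_extremePoints_iff_forall_segment.1 hq
  obtain ⟨a, ha, b, hb, hqab⟩ := mem_convexJoin.1 hq
  rcases hq_extreme a (subset_convexJoin_left ht ha) b (subset_convexJoin_right hs hb) hqab
    with rfl | rfl
  · exact .inl ha
  · exact .inr hb

variable [TopologicalSpace E] [IsTopologicalAddGroup E] [ContinuousSMul ℝ E]

theorem isCompact_convexJoin {s t : Set E} (hs : IsCompact s) (ht : IsCompact t) :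
    IsCompact (convexJoin ℝ s t) := by
  have eq_image : convexJoin ℝ s t =
      (fun p : (E × E) × ℝ => AffineMap.lineMap p.1.1 p.1.2 p.2) '' ((s ×ˢ t) ×ˢ Set.Icc 0 1) := by
    ext z
    simp only [mem_convexJoin, segment_eq_image_lineMap, Set.mem_image, Set.mem_prod, Prod.exists]
    aesop
  rw [eq_image]
  refine ((hs.prod ht).prod isCompact_Icc).image ?_
  simp only [AffineMap.lineMap_apply_module]
  fun_prop

theorem mem_closure_convexHull_or_of_mem_extremePoints [T2Space E] {s t : Set E}
    (hst : IsCompact (closure (convexHull ℝ (s ∪ t)))) {q : E}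
    (hq : q ∈ (closure (convexHull ℝ (s ∪ t))).extremePoints ℝ) :
    q ∈ closure (convexHull ℝ s) ∨ q ∈ closure (convexHull ℝ t) := by
  rcases s.eq_empty_or_nonempty with rfl | hs
  · exact .inr (by simpa using hq.1)
  rcases t.eq_empty_or_nonempty with rfl | ht
  · exact .inl (by simpa using hq.1)
  have hs_compact := hst.of_isClosed_subset isClosed_closure
    (closure_mono (convexHull_mono (Set.subset_union_left (t := t))))
  have ht_compact := hst.of_isClosed_subset isClosed_closure
    (closure_mono (convexHull_mono (Set.subset_union_right (s := s))))
  have hull_subset : closure (convexHull ℝ (s ∪ t)) ⊆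
      convexJoin ℝ (closure (convexHull ℝ s)) (closure (convexHull ℝ t)) := by
    refine closure_minimal (convexHull_min (Set.union_subset ?_ ?_) ?_)
      (isCompact_convexJoin hs_compact ht_compact).isClosed
    · exact ((subset_convexHull ℝ s).trans subset_closure).trans
        (subset_convexJoin_left ht.convexHull.closure)
    · exact ((subset_convexHull ℝ t).trans subset_closure).trans
        (subset_convexJoin_right hs.convexHull.closure)
    · exact (convex_convexHull ℝ s).closure.convexJoin (convex_convexHull ℝ t).closure
  have join_subset : convexJoin ℝ (closure (convexHull ℝ s)) (closure (convexHull ℝ t)) ⊆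
      closure (convexHull ℝ (s ∪ t)) :=
    convexJoin_subset (closure_mono (convexHull_mono Set.subset_union_left))
      (closure_mono (convexHull_mono Set.subset_union_right))
      (convex_convexHull ℝ (s ∪ t)).closure
  rw [hull_subset.antisymm join_subset] at hq
  exact mem_or_mem_of_mem_extremePoints_convexJoin hs.convexHull.closure ht.convexHull.closure hq

variable [T2Space E] [LocallyConvexSpace ℝ E]

/-- Compactness reduces the claim to small pieces of `A`, which half-spaces separate from `q`;
passing to unions is the two-set case above. -/
theorem mem_closure_of_mem_extremePoints_closure_convexHull {A : Set E}
    (hA : IsCompact (closure (convexHull ℝ A))) {q : E}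
    (hq : q ∈ (closure (convexHull ℝ A)).extremePoints ℝ) : q ∈ closure A := by
  by_contra hqA
  have avoids : q ∉ closure (convexHull ℝ (closure A ∩ A)) := by
    have hclosure : IsCompact (closure A) :=
      hA.of_isClosed_subset isClosed_closure (closure_mono (subset_convexHull ℝ A))
    refine hclosure.induction_on (p := fun s => q ∉ closure (convexHull ℝ (s ∩ A)))
      (by simp) (fun s t hst ht hs => ht ?_) (fun s t hs ht hst => ?_) fun x hx => ?_
    · exact closure_mono (convexHull_mono (Set.inter_subset_inter_left A hst)) hs
    · rw [Set.union_inter_distrib_right] at hst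
      have hsub : closure (convexHull ℝ (s ∩ A ∪ t ∩ A)) ⊆ closure (convexHull ℝ A) :=
        closure_mono (convexHull_mono
          (Set.union_subset Set.inter_subset_right Set.inter_subset_right))
      exact (mem_closure_convexHull_or_of_mem_extremePoints
        (hA.of_isClosed_subset isClosed_closure hsub)
        (inter_extremePoints_subset_extremePoints_of_subset hsub ⟨hst, hq⟩)).elim hs ht
    · obtain ⟨f, hf⟩ := geometric_hahn_banach_point_point (ne_of_mem_of_not_mem hx hqA)
      obtain ⟨c, hxc, hcq⟩ := exists_between hf
      refine ⟨{y | f y ≤ c}, mem_nhdsWithin_of_mem_nhds ?_, fun hmem => ?_⟩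
      · exact f.continuous.continuousAt.eventually_le_const hxc
      · have hsub : closure (convexHull ℝ ({y | f y ≤ c} ∩ A)) ⊆ {y | f y ≤ c} :=
          closure_minimal (convexHull_min Set.inter_subset_left
            (convex_halfSpace_le f.toLinearMap.isLinear c))
            (isClosed_le f.continuous continuous_const)
        exact hcq.not_ge (hsub hmem)
  exact avoids (by rw [Set.inter_eq_right.2 subset_closure]; exact hq.1)

end Milman

/-! ### States of `C(X)` and point masses -/

theorem exists_finite_partition_of_unity_dist_lt {X Z : Type*} [TopologicalSpace X] [CompactSpace X]
    [T2Space X] [PseudoMetricSpace Z] (F : C(X, Z)) {ε : ℝ} (hε : 0 < ε) :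
    ∃ (t : Finset X) (h : t → C(X, ℝ)), 0 ≤ h ∧ ∑ k, h k = 1 ∧
      ∀ k x, h k x ≠ 0 → dist (F x) (F k) < ε := by
  let U (x : X) : Set X := F ⁻¹' Metric.ball (F x) ε
  have hU (x : X) : IsOpen (U x) := Metric.isOpen_ball.preimage F.continuous
  obtain ⟨t, ht⟩ := CompactSpace.elim_nhds_subcover U
    fun x => (hU x).mem_nhds (Metric.mem_ball_self hε)
  obtain ⟨p, hp⟩ := PartitionOfUnity.exists_isSubordinate (s := Set.univ) isClosed_univ
    (fun k : t => U k) (fun k => hU k)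
    (by rw [← Set.iUnion_subtype (· ∈ t) fun k => U k] at ht; exact ht.ge)
  refine ⟨t, p, p.nonneg, ?_, fun k x hx => hp k (subset_tsupport _ hx)⟩
  ext x
  rw [ContinuousMap.sum_apply, ← finsum_eq_sum_of_fintype]
  exact p.sum_eq_one (Set.mem_univ x)

theorem exists_partition_of_unity_approx {X κ : Type*} [TopologicalSpace X] [CompactSpace X]
    [T2Space X] [Finite κ] (f : κ → C(X, ℂ)) {ε : ℝ} (hε : 0 < ε) :
    ∃ (t : Finset X) (h : t → C(X, ℂ)), (∀ k, 0 ≤ h k) ∧ ∑ k, h k = 1 ∧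
      ∀ i, ‖f i - ∑ k : t, f i k • h k‖ ≤ ε := by
  have := Fintype.ofFinite κ
  obtain ⟨t, h, hnonneg, hsum, hdist⟩ :=
    exists_finite_partition_of_unity_dist_lt (ContinuousMap.pi f) hε
  replace hsum (x : X) : ∑ k, h k x = 1 := by
    simpa [ContinuousMap.sum_apply] using DFunLike.congr_fun hsum x
  refine ⟨t, fun k => (Complex.ofRealCLM : C(ℝ, ℂ)).comp (h k),
    fun k x => Complex.zero_le_real.2 (hnonneg k x), ?_, fun i => ?_⟩
  · ext x
    simpa [ContinuousMap.sum_apply] using congrArg Complex.ofReal (hsum x)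
  · rw [ContinuousMap.norm_le _ hε.le]
    intro x
    have combination : (f i - ∑ k : t, f i k • (Complex.ofRealCLM : C(ℝ, ℂ)).comp (h k)) x =
        ∑ k, (h k x : ℂ) * (f i x - f i k) := by
      simp only [mul_sub, Finset.sum_sub_distrib, ← Finset.sum_mul, ← Complex.ofReal_sum, hsum]
      simp [ContinuousMap.sum_apply, mul_comm]
    calc ‖(f i - ∑ k : t, f i k • (Complex.ofRealCLM : C(ℝ, ℂ)).comp (h k)) x‖
        ≤ ∑ k, ‖(h k x : ℂ) * (f i x - f i k)‖ := by
          rw [combination]; exact norm_sum_le _ _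
      _ ≤ ∑ k, h k x * ε := by
          refine Finset.sum_le_sum fun k _ => ?_
          have hkx : ‖h k x‖ = h k x := Real.norm_of_nonneg (hnonneg k x)
          rw [norm_mul, Complex.norm_real, hkx]
          by_cases hk : h k x = 0
          · simp [hk]
          · have hle : dist (f i x) (f i k) ≤ ε :=
              (dist_le_pi_dist (fun i => f i x) (fun i => f i k) i).trans (hdist k x hk).le
            rw [dist_eq_norm] at hle
            exact mul_le_mul_of_nonneg_left hle (hnonneg k x)
      _ = ε := by rw [← Finset.sum_mul, hsum, one_mul]

/-- Evaluation at `x`, as a state of `C(X)`: the Dirac measure at `x`. -/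
noncomputable def pointMass {X : Type*} [TopologicalSpace X] (x : X) : C(X, ℂ) → ℂ := fun f => f x

section PointMass

variable {X : Type*} [TopologicalSpace X]

theorem continuous_pointMass : Continuous (pointMass : X → C(X, ℂ) → ℂ) :=
  continuous_pi fun f => f.continuous

theorem pointMass_mem_stateSpace (x : X) : pointMass x ∈ stateSpace C(X, ℂ) :=
  ⟨(ContinuousMap.evalStarAlgHom ℂ ℂ x).toAlgHom.toLinearMap, ⟨rfl, fun _ hf => hf x⟩, rfl⟩

variable [CompactSpace X] [T2Space X]

theorem pointMass_injective : Function.Injective (pointMass : X → C(X, ℂ) → ℂ) := by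
  intro x y hxy
  apply (WeakDual.CharacterSpace.continuousMapEval_bijective (X := X) (𝕜 := ℂ)).injective
  ext f
  exact congrFun hxy f

theorem stateSpace_subset_closure_convexHull_pointMass :
    stateSpace C(X, ℂ) ⊆ closure (convexHull ℝ (Set.range (pointMass : X → C(X, ℂ) → ℂ))) := by
  rintro _ ⟨L, hL, rfl⟩
  refine mem_closure_iff_nhds.2 fun U hU => ?_
  rw [nhds_pi, Filter.mem_pi] at hU
  obtain ⟨I, hI, V, hV, hVU⟩ := hU
  obtain ⟨ε, hε, hεV⟩ : ∃ ε > 0, ∀ f ∈ I, Metric.closedBall (L f) ε ⊆ V f := by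
    have small : ∀ᶠ ε in nhdsWithin (0 : ℝ) (Set.Ioi 0),
        ∀ f ∈ I, Metric.closedBall (L f) ε ⊆ V f := by
      refine (Filter.eventually_all_finite hI).2 fun f _ =>
        nhdsWithin_le_nhds (eventually_closedBall_subset (hV f))
    obtain ⟨ε, hεV, hε⟩ := (small.and self_mem_nhdsWithin).exists
    exact ⟨ε, hε, hεV⟩
  have := hI.to_subtype
  obtain ⟨t, h, hnonneg, hsum, happrox⟩ :=
    exists_partition_of_unity_approx (fun f : I => (f : C(X, ℂ))) hε
  have hre (k : t) : ((L (h k)).re : ℂ) = L (h k) := by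
    have hk := Complex.le_def.1 (hL.map_nonneg _ (hnonneg k))
    exact Complex.ext rfl hk.2
  refine ⟨∑ k, (L (h k)).re • pointMass (k : X), hVU fun f hf => hεV f hf ?_, ?_⟩
  · have hLf : L (f - ∑ k : t, f k • h k) = L f - ∑ k : t, (L (h k)).re • f k := by
      simp [map_sum, hre, mul_comm]
    rw [Metric.mem_closedBall', dist_eq_norm, Finset.sum_apply]
    exact (congrArg norm hLf).symm.trans_le ((hL.norm_le _).trans (happrox ⟨f, hf⟩))
  · refine (convex_convexHull ℝ _).sum_mem (fun k _ => ?_) ?_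
      fun k _ => subset_convexHull ℝ _ ⟨k, rfl⟩
    · exact (Complex.le_def.1 (hL.map_nonneg _ (hnonneg k))).1
    · have : ∑ k, L (h k) = 1 := by rw [← map_sum, hsum, hL.map_one]
      simpa using congrArg Complex.re this

theorem closure_convexHull_pointMass :
    closure (convexHull ℝ (Set.range (pointMass : X → C(X, ℂ) → ℂ))) = stateSpace C(X, ℂ) :=
  (closure_minimal (convexHull_min (Set.range_subset_iff.2 pointMass_mem_stateSpace)
    stateSpace.convex) stateSpace.isClosed).antisymm stateSpace_subset_closure_convexHull_pointMass

theorem extremePoints_stateSpace_subset :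
    (stateSpace C(X, ℂ)).extremePoints ℝ ⊆ Set.range (pointMass : X → C(X, ℂ) → ℂ) := by
  intro ℓ hℓ
  rw [← (isCompact_range continuous_pointMass).isClosed.closure_eq]
  rw [← closure_convexHull_pointMass] at hℓ
  refine mem_closure_of_mem_extremePoints_closure_convexHull ?_ hℓ
  rw [closure_convexHull_pointMass]
  exact stateSpace.isCompact

end PointMass

/-! ### Barycenters -/

section Barycenter

variable {E : Type*} [AddCommGroup E] [Module ℝ E] [TopologicalSpace E]

/-- A continuous linear functional, as a complex-valued continuous function on `X ⊆ E`. -/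
noncomputable def dualRestrict (X : Set E) (f : E →L[ℝ] ℝ) : C(X, ℂ) :=
  ⟨fun x => (f x : ℂ), by fun_prop⟩

/-- `b` is the barycenter of the state `ℓ` of `C(X)`, where `X ⊆ E`. -/
def IsBarycenter {X : Set E} (ℓ : C(X, ℂ) → ℂ) (b : E) : Prop :=
  ∀ f : E →L[ℝ] ℝ, ℓ (dualRestrict X f) = f b

variable {X Q : Set E}

theorem isBarycenter_pointMass (x : X) : IsBarycenter (pointMass x) (x : E) := fun _ => rfl

theorem isClosed_setOf_isBarycenter :
    IsClosed {p : (C(X, ℂ) → ℂ) × E | IsBarycenter p.1 p.2} := by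
  simp only [IsBarycenter, Set.ofPred_forall]
  exact isClosed_iInter fun f => isClosed_eq (by fun_prop) (by fun_prop)

theorem IsBarycenter.combination {ℓ ℓ' : C(X, ℂ) → ℂ} {b b' : E} (h : IsBarycenter ℓ b)
    (h' : IsBarycenter ℓ' b') (s t : ℝ) : IsBarycenter (s • ℓ + t • ℓ') (s • b + t • b') := by
  intro f
  simp [h f, h' f]

variable [T2Space E] [CompactSpace X]

theorem exists_isBarycenter (hQ : IsCompact Q) (hQ_convex : Convex ℝ Q) (hXQ : X ⊆ Q)
    {ℓ : C(X, ℂ) → ℂ} (hℓ : ℓ ∈ stateSpace C(X, ℂ)) : ∃ b ∈ Q, IsBarycenter ℓ b := by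
  let Γ : Set ((C(X, ℂ) → ℂ) × E) := (stateSpace C(X, ℂ) ×ˢ Q) ∩ {p | IsBarycenter p.1 p.2}
  have hΓ : IsCompact Γ := (stateSpace.isCompact.prod hQ).inter_right isClosed_setOf_isBarycenter
  have hΓ_convex : Convex ℝ Γ := by
    rintro p ⟨⟨hp, hpQ⟩, hpb⟩ p' ⟨⟨hp', hpQ'⟩, hpb'⟩ s t hs ht hst
    exact ⟨⟨stateSpace.convex hp hp' hs ht hst, hQ_convex hpQ hpQ' hs ht hst⟩,
      hpb.combination hpb' s t⟩
  have subset_image : stateSpace C(X, ℂ) ⊆ Prod.fst '' Γ := by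
    rw [← closure_convexHull_pointMass]
    refine closure_minimal (convexHull_min ?_ (hΓ_convex.is_linear_image ?_))
      (hΓ.image continuous_fst).isClosed
    · rintro _ ⟨x, rfl⟩
      exact ⟨(pointMass x, x), ⟨⟨pointMass_mem_stateSpace x, hXQ x.2⟩, isBarycenter_pointMass x⟩,
        rfl⟩
    · exact (LinearMap.fst ℝ _ _).isLinear
  obtain ⟨⟨_, b⟩, ⟨⟨-, hb⟩, hℓb⟩, rfl⟩ := subset_image hℓ
  exact ⟨b, hb, hℓb⟩

variable [IsTopologicalAddGroup E] [ContinuousSMul ℝ E] [LocallyConvexSpace ℝ E]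

omit [CompactSpace X] in
theorem IsBarycenter.unique {ℓ : C(X, ℂ) → ℂ} {b b' : E} (h : IsBarycenter ℓ b)
    (h' : IsBarycenter ℓ b') : b = b' := by
  rw [SeparatingDual.eq_iff_forall_dual_eq (R := ℝ)]
  intro f
  exact_mod_cast (h f).symm.trans (h' f)

theorem isExtreme_setOf_isBarycenter (hQ : IsCompact Q) (hQ_convex : Convex ℝ Q) (hXQ : X ⊆ Q)
    {q : E} (hq : q ∈ Q.extremePoints ℝ) :
    IsExtreme ℝ (stateSpace C(X, ℂ)) (stateSpace C(X, ℂ) ∩ {ℓ | IsBarycenter ℓ q}) := by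
  refine ⟨Set.inter_subset_left, ?_⟩
  rintro ℓ₁ h₁ ℓ₂ h₂ _ ⟨-, h₁₂⟩ ⟨s, t, hs, ht, hst, rfl⟩
  obtain ⟨b₁, hb₁, hℓ₁⟩ := exists_isBarycenter hQ hQ_convex hXQ h₁
  obtain ⟨b₂, hb₂, hℓ₂⟩ := exists_isBarycenter hQ hQ_convex hXQ h₂
  have hq_eq : s • b₁ + t • b₂ = q := (hℓ₁.combination hℓ₂ s t).unique h₁₂
  have : b₁ = q := hq.2 hb₁ hb₂ ⟨s, t, hs, ht, hst, hq_eq⟩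
  exact ⟨h₁, this ▸ hℓ₁⟩

theorem eq_pointMass_of_isBarycenter_extreme (hQ : IsCompact Q) (hQ_convex : Convex ℝ Q)
    (hXQ : X ⊆ Q) {q : E} (hq : q ∈ Q.extremePoints ℝ) {ℓ : C(X, ℂ) → ℂ}
    (hℓ : ℓ ∈ stateSpace C(X, ℂ)) (hℓq : IsBarycenter ℓ q) :
    ∃ x : X, (x : E) = q ∧ ℓ = pointMass x := by
  let F : Set (C(X, ℂ) → ℂ) := stateSpace C(X, ℂ) ∩ {ℓ | IsBarycenter ℓ q}
  have hF : IsCompact F := stateSpace.isCompact.inter_right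
    (isClosed_setOf_isBarycenter.preimage (by fun_prop : Continuous fun ℓ => (ℓ, q)))
  have hF_convex : Convex ℝ F := by
    rintro ℓ₁ ⟨h₁, hb₁⟩ ℓ₂ ⟨h₂, hb₂⟩ s t hs ht hst
    refine ⟨stateSpace.convex h₁ h₂ hs ht hst, ?_⟩
    simpa [← add_smul, hst] using hb₁.combination hb₂ s t
  have extreme_eq (ℓ') (h : ℓ' ∈ F.extremePoints ℝ) :
      ∃ x : X, (x : E) = q ∧ ℓ' = pointMass x := by
    obtain ⟨x, rfl⟩ := extremePoints_stateSpace_subset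
      ((isExtreme_setOf_isBarycenter hQ hQ_convex hXQ hq).extremePoints_subset_extremePoints h)
    exact ⟨x, (isBarycenter_pointMass x).unique h.1.2, rfl⟩
  obtain ⟨ℓ₀, hℓ₀⟩ := hF.extremePoints_nonempty ⟨ℓ, hℓ, hℓq⟩
  obtain ⟨x, hx, -⟩ := extreme_eq ℓ₀ hℓ₀
  have extreme_subset : F.extremePoints ℝ ⊆ {pointMass x} := by
    intro ℓ' h
    obtain ⟨y, hy, rfl⟩ := extreme_eq ℓ' h
    exact congrArg pointMass (Subtype.ext (hy.trans hx.symm))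
  have hF_subset : F ⊆ {pointMass x} := by
    rw [← closure_convexHull_extremePoints hF hF_convex]
    exact closure_minimal (convexHull_min extreme_subset (convex_singleton _)) isClosed_singleton
  exact ⟨x, hx, hF_subset ⟨hℓ, hℓq⟩⟩

end Barycenter

/-! ### Group actions on states -/

/-- The action of `G` on vector-valued functions on a `G`-set, `(s f)(i) = f (s⁻¹ i)`. It is only a
local instance, because it competes with the pointwise action on functions. -/
abbrev arrowDistribMulAction {G : Type*} [Group G] {I : Type*} [MulAction G I] {V : Type*}
    [AddMonoid V] : DistribMulAction G (I → V) where
  toMulAction := arrowAction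
  smul_zero _ := rfl
  smul_add _ _ _ := rfl

/-- The action of `G` on `C(X)` by translations, `(s f)(x) = f (s⁻¹ x)`. -/
noncomputable abbrev translateAction {G : Type*} [Group G] {X : Type*} [TopologicalSpace X]
    [MulAction G X] [ContinuousConstSMul G X] : MulAction G C(X, ℂ) where
  smul := translateFun
  one_smul f := ContinuousMap.ext fun x => congrArg f (by simp)
  mul_smul s t f := ContinuousMap.ext fun x => congrArg f (by simp [mul_smul])

attribute [local instance] arrowDistribMulAction translateAction

section ArrowAction

variable {G : Type*} [Group G] {I : Type*} [MulAction G I] {V : Type*}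

theorem arrow_smul_apply [AddMonoid V] (s : G) (f : I → V) (i : I) : (s • f) i = f (s⁻¹ • i) := rfl

theorem arrow_continuousConstSMul [AddMonoid V] [TopologicalSpace V] :
    ContinuousConstSMul G (I → V) :=
  ⟨fun s => continuous_pi fun i => continuous_apply (s⁻¹ • i)⟩

theorem arrow_smulCommClass [AddCommGroup V] [Module ℝ V] : SMulCommClass G ℝ (I → V) :=
  ⟨fun _ _ _ => rfl⟩

end ArrowAction

section Translate

variable {G : Type*} [Group G] {X : Type*} [TopologicalSpace X] [MulAction G X]
  [ContinuousConstSMul G X]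

theorem smul_pointMass (s : G) (x : X) : s • pointMass x = pointMass (s • x) :=
  funext fun f => congrArg f (by simp)

theorem smul_mem_stateSpace (s : G) {ℓ : C(X, ℂ) → ℂ} (hℓ : ℓ ∈ stateSpace C(X, ℂ)) :
    s • ℓ ∈ stateSpace C(X, ℂ) := by
  let T : C(X, ℂ) →ₗ[ℂ] C(X, ℂ) :=
    { toFun := translateFun s⁻¹
      map_add' := fun _ _ => rfl
      map_smul' := fun _ _ => rfl }
  have hT : IsUnitalPositive T := ⟨rfl, fun f hf x => hf (s⁻¹⁻¹ • x)⟩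
  exact hT.precomp_mem_stateSpace hℓ

end Translate

/-! ### States and regular Borel probability measures -/

section Measures

open MeasureTheory Filter Topology

variable {X : Type*} [TopologicalSpace X]

/-- Integration against a probability measure, as a state of `C(X)`. -/
noncomputable def integralState [MeasurableSpace X] (μ : ProbabilityMeasure X) : C(X, ℂ) → ℂ :=
  fun f => ∫ x, f x ∂(μ : Measure X)

theorem integralState_diracProba [MeasurableSpace X] [BorelSpace X] (x : X) :
    integralState (diracProba x) = pointMass x :=
  funext fun f => integral_dirac' (fun y => f y) x f.continuous.measurable.stronglyMeasurable

section Compact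

variable [CompactSpace X] [MeasurableSpace X] [BorelSpace X]

theorem integrable_continuousMap (μ : ProbabilityMeasure X) (f : C(X, ℂ)) :
    Integrable f (μ : Measure X) :=
  (BoundedContinuousFunction.mkOfCompact f).integrable _

theorem integralState_mem_stateSpace (μ : ProbabilityMeasure X) :
    integralState μ ∈ stateSpace C(X, ℂ) := by
  let L : C(X, ℂ) →ₗ[ℂ] ℂ :=
    { toFun := integralState μ
      map_add' := fun f g =>
        integral_add (integrable_continuousMap μ f) (integrable_continuousMap μ g)
      map_smul' := fun c f => integral_smul c f }
  refine ⟨L, ⟨?_, fun f hf => integral_nonneg fun x => hf x⟩, rfl⟩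
  change ∫ _, (1 : ℂ) ∂(μ : Measure X) = 1
  simp

theorem isInducing_integralState :
    IsInducing (integralState : ProbabilityMeasure X → C(X, ℂ) → ℂ) := by
  have tendsto_iff {F : Filter (ProbabilityMeasure X)} {μ : ProbabilityMeasure X} :
      Tendsto id F (𝓝 μ) ↔ Tendsto integralState F (𝓝 (integralState μ)) := by
    rw [ProbabilityMeasure.tendsto_iff_forall_integral_rclike_tendsto ℂ, tendsto_pi_nhds]
    exact ⟨fun h f => h (BoundedContinuousFunction.mkOfCompact f), fun h f => h f.toContinuousMap⟩
  exact isInducing_iff_nhds.2 fun μ =>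
    (tendsto_iff.1 tendsto_id).le_comap.antisymm (tendsto_iff.2 tendsto_comap)

end Compact

theorem exists_regular_measure_of_nonneg [CompactSpace X] [T2Space X] [MeasurableSpace X]
    [BorelSpace X] (Λ : C(X, ℝ) →ₗ[ℝ] ℝ) (hΛ : ∀ f, 0 ≤ f → 0 ≤ Λ f) :
    ∃ μ : Measure X, μ.Regular ∧ ∀ f : C(X, ℝ), ∫ x, f x ∂μ = Λ f := by
  let Λ' : CompactlySupportedContinuousMap X ℝ →ₚ[ℝ] ℝ := PositiveLinearMap.mk₀
    { toFun := fun f => Λ f.toContinuousMap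
      map_add' := fun f g => Λ.map_add _ _
      map_smul' := fun c f => Λ.map_smul _ _ }
    fun f hf => hΛ _ hf
  exact ⟨RealRMK.rieszMeasure Λ', inferInstance, fun f =>
    RealRMK.integral_rieszMeasure Λ' ⟨f, HasCompactSupport.of_compactSpace _⟩⟩

theorem exists_integralState_eq [CompactSpace X] [T2Space X] [MeasurableSpace X] [BorelSpace X]
    {ℓ : C(X, ℂ) → ℂ} (hℓ : ℓ ∈ stateSpace C(X, ℂ)) :
    ∃ μ : ProbabilityMeasure X, (μ : Measure X).Regular ∧ integralState μ = ℓ := by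
  obtain ⟨L, hL, rfl⟩ := hℓ
  let ofReal : C(X, ℝ) →ₗ[ℝ] C(X, ℂ) := Complex.ofRealCLM.compLeftContinuous ℝ X
  let Λ : C(X, ℝ) →ₗ[ℝ] ℝ := Complex.reLm ∘ₗ L.restrictScalars ℝ ∘ₗ ofReal
  have L_ofReal (f : C(X, ℝ)) : L (ofReal f) = Λ f := by
    have : IsSelfAdjoint (ofReal f) := ContinuousMap.ext fun x => Complex.conj_ofReal (f x)
    exact Complex.ext rfl (hL.im_eq_zero_of_isSelfAdjoint this)
  obtain ⟨μ, hμ, hint⟩ := exists_regular_measure_of_nonneg Λ fun f hf =>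
    (Complex.le_def.1 (hL.map_nonneg (ofReal f) fun x => Complex.zero_le_real.2 (hf x))).1
  have : IsProbabilityMeasure μ := by
    have h_one : ∫ _, (1 : ℝ) ∂μ = (L 1).re := by
      have : ofReal 1 = 1 := ContinuousMap.ext fun _ => Complex.ofReal_one
      exact (hint 1).trans (by simp [Λ, this])
    rw [hL.map_one] at h_one
    simp only [integral_const, smul_eq_mul, mul_one, Complex.one_re, Measure.real] at h_one
    exact ⟨(ENNReal.toReal_eq_one_iff _).1 h_one⟩
  refine ⟨⟨μ, this⟩, hμ, funext fun f => ?_⟩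
  let re_f : C(X, ℝ) := ⟨fun x => (f x).re, by fun_prop⟩
  let im_f : C(X, ℝ) := ⟨fun x => (f x).im, by fun_prop⟩
  have hf : f = ofReal re_f + Complex.I • ofReal im_f :=
    ContinuousMap.ext fun x => by simp [ofReal, re_f, im_f, mul_comm Complex.I]
  calc ∫ x, f x ∂μ = (∫ x, re_f x ∂μ : ℝ) + (∫ x, im_f x ∂μ : ℝ) * Complex.I :=
        (integral_re_add_im (integrable_continuousMap ⟨μ, this⟩ f)).symm
    _ = L f := by
        rw [hint, hint, ← L_ofReal, ← L_ofReal, hf]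
        simp [mul_comm]

section Dynamics

variable {G : Type*} [Group G] [MulAction G X] [ContinuousConstSMul G X]

theorem integralState_map_smul [MeasurableSpace X] [BorelSpace X] (μ : ProbabilityMeasure X)
    (s : G) :
    integralState (μ.map (continuous_const_smul s).measurable.aemeasurable) =
      s • integralState μ := by
  funext f
  have h := integral_map (μ := (μ : Measure X)) (continuous_const_smul s).measurable.aemeasurable
    f.continuous.measurable.aestronglyMeasurable
  refine h.trans (integral_congr_ae (Eventually.of_forall fun _ => congrArg f ?_))
  rw [inv_inv]

theorem isStronglyProximal_iff [CompactSpace X] [T2Space X] :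
    IsStronglyProximal G X ↔ ∀ ℓ ∈ stateSpace C(X, ℂ),
      ∃ x : X, pointMass x ∈ closure (MulAction.orbit G ℓ) := by
  let : MeasurableSpace X := borel X
  have : BorelSpace X := ⟨rfl⟩
  have mem_closure_iff (μ : ProbabilityMeasure X) (x : X) :
      diracProba x ∈ closure (Set.range fun s : G =>
          μ.map (continuous_const_smul s).measurable.aemeasurable) ↔
        pointMass x ∈ closure (MulAction.orbit G (integralState μ)) := by
    rw [isInducing_integralState.closure_eq_preimage_closure_image, Set.mem_preimage,
      integralState_diracProba, ← Set.range_comp]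
    simp only [Function.comp_def, integralState_map_smul, MulAction.orbit]
  constructor
  · intro h ℓ hℓ
    obtain ⟨μ, hμ, rfl⟩ := exists_integralState_eq hℓ
    exact (h μ hμ).imp fun x => (mem_closure_iff μ x).1
  · intro h μ _
    exact (h _ (integralState_mem_stateSpace μ)).imp fun x => (mem_closure_iff μ x).2

end Dynamics

end Measures

/-! ### Boundaries in compact convex sets -/

section CompactConvex

open scoped Pointwise
open MulAction

/-- `K` is a nonempty compact convex `G`-invariant subset. -/
structure IsCompactConvexInvariant (G : Type*) [Group G] {E : Type*} [AddCommGroup E] [Module ℝ E]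
    [TopologicalSpace E] [DistribMulAction G E] (K : Set E) : Prop where
  nonempty : K.Nonempty
  isCompact : IsCompact K
  convex : Convex ℝ K
  smul_mem : ∀ (s : G), ∀ x ∈ K, s • x ∈ K

variable {G : Type*} [Group G] {E : Type*} [AddCommGroup E] [Module ℝ E] [TopologicalSpace E]
  [DistribMulAction G E] {K Q : Set E} {x q : E}

theorem IsCompactConvexInvariant.orbit_subset (hK : IsCompactConvexInvariant G K) (hx : x ∈ K) :
    orbit G x ⊆ K :=
  Set.range_subset_iff.2 fun s => hK.smul_mem s x hx

theorem smul_closure_convexHull_orbit [SMulCommClass G ℝ E] [ContinuousConstSMul G E] (s : G)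
    (x : E) : s • closure (convexHull ℝ (orbit G x)) = closure (convexHull ℝ (orbit G x)) := by
  have smul_convexHull : s • convexHull ℝ (orbit G x) = convexHull ℝ (s • orbit G x) :=
    (DistribSMul.toLinearMap ℝ E s).image_convexHull _
  rw [← closure_smul, smul_convexHull, smul_orbit]

variable [T2Space E]

theorem IsCompactConvexInvariant.sInter {c : Set (Set E)}
    (hc : ∀ K ∈ c, IsCompactConvexInvariant G K) (hchain : IsChain (· ⊆ ·) c) (hne : c.Nonempty) :
    IsCompactConvexInvariant G (⋂₀ c) where
  nonempty := by
    have : Nonempty c := hne.to_subtype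
    have hdirected : DirectedOn (fun K L : Set E => K ⊇ L) c := fun K hK L hL =>
      (hchain.total hK hL).elim (fun h => ⟨K, hK, subset_rfl, h⟩) fun h => ⟨L, hL, h, subset_rfl⟩
    exact IsCompact.nonempty_sInter_of_directed_nonempty_isCompact_isClosed hdirected
      (fun K hK => (hc K hK).nonempty) (fun K hK => (hc K hK).isCompact)
      fun K hK => (hc K hK).isCompact.isClosed
  isCompact := by
    obtain ⟨K, hK⟩ := hne
    exact (hc K hK).isCompact.of_isClosed_subset
      (isClosed_sInter fun L hL => (hc L hL).isCompact.isClosed) (Set.sInter_subset_of_mem hK)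
  convex := convex_sInter fun K hK => (hc K hK).convex
  smul_mem s x hx K hK := (hc K hK).smul_mem s x (hx K hK)

theorem IsCompactConvexInvariant.exists_minimal (hK : IsCompactConvexInvariant G K) :
    ∃ Q ⊆ K, Minimal (IsCompactConvexInvariant G) Q :=
  zorn_superset_nonempty {Q | IsCompactConvexInvariant G Q} (fun c hc hchain hne =>
    ⟨⋂₀ c, .sInter (fun _ hQ => hc hQ) hchain hne, fun _ => Set.sInter_subset_of_mem⟩) K hK

variable [IsTopologicalAddGroup E] [ContinuousSMul ℝ E] [SMulCommClass G ℝ E]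
  [ContinuousConstSMul G E]

theorem closure_convexHull_orbit_eq_of_minimal (hQ : Minimal (IsCompactConvexInvariant G) Q)
    (hx : x ∈ Q) : closure (convexHull ℝ (orbit G x)) = Q := by
  have hsub : closure (convexHull ℝ (orbit G x)) ⊆ Q :=
    closure_minimal (convexHull_min (hQ.prop.orbit_subset hx) hQ.prop.convex)
      hQ.prop.isCompact.isClosed
  refine hQ.eq_of_subset ⟨⟨x, subset_closure (subset_convexHull ℝ _ (mem_orbit_self x))⟩,
    hQ.prop.isCompact.of_isClosed_subset isClosed_closure hsub, (convex_convexHull ℝ _).closure,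
    fun s y hy => ?_⟩ hsub
  rw [← smul_closure_convexHull_orbit s x]
  exact Set.smul_mem_smul_set hy

theorem mem_closure_orbit_of_mem_extremePoints [LocallyConvexSpace ℝ E]
    (hQ : Minimal (IsCompactConvexInvariant G) Q) (hq : q ∈ Q.extremePoints ℝ) (hx : x ∈ Q) :
    q ∈ closure (orbit G x) := by
  rw [← closure_convexHull_orbit_eq_of_minimal hQ hx] at hq
  refine mem_closure_of_mem_extremePoints_closure_convexHull ?_ hq
  rw [closure_convexHull_orbit_eq_of_minimal hQ hx]
  exact hQ.prop.isCompact

end CompactConvex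

section OrbitClosure

open scoped Pointwise
open MulAction

variable {G : Type*} [Group G] {E : Type*} [TopologicalSpace E] [MulAction G E]
  [ContinuousConstSMul G E]

/-- The closure of the orbit of `x`, as a `G`-invariant subset. -/
def orbitClosure (G : Type*) [Group G] {E : Type*} [TopologicalSpace E] [MulAction G E]
    [ContinuousConstSMul G E] (x : E) : SubMulAction G E where
  carrier := closure (orbit G x)
  smul_mem' s _ hy := smul_closure_orbit_subset s x (Set.smul_mem_smul_set hy)

theorem orbitClosure_subset_closure_orbit {x y : E} (h : x ∈ closure (orbit G y)) :
    (orbitClosure G x : Set E) ⊆ closure (orbit G y) :=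
  closure_minimal (Set.range_subset_iff.2 fun s => (orbitClosure G y).smul_mem s h) isClosed_closure

theorem continuousConstSMul_subMulAction (X : SubMulAction G E) : ContinuousConstSMul G X :=
  ⟨fun s => ((continuous_const_smul s).comp continuous_subtype_val).subtype_mk _⟩

theorem isMinimal_orbitClosure {x : E}
    (h : ∀ y ∈ closure (orbit G x), x ∈ closure (orbit G y)) : IsMinimal G (orbitClosure G x) where
  dense_orbit y z := by
    rw [Topology.IsInducing.subtypeVal.closure_eq_preimage_closure_image, Set.mem_preimage,
      SubMulAction.val_image_orbit]
    exact orbitClosure_subset_closure_orbit (h y y.2) z.2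

end OrbitClosure

section Glasner

open MulAction

attribute [local instance] continuousConstSMul_subMulAction

variable {G : Type*} [Group G] {E : Type*} [AddCommGroup E] [Module ℝ E] [TopologicalSpace E]
  [DistribMulAction G E] [SMulCommClass G ℝ E] [ContinuousConstSMul G E]

theorem IsBarycenter.smul {X : SubMulAction G E} {ℓ : C(X, ℂ) → ℂ} {b : E}
    (h : IsBarycenter (X := (X : Set E)) ℓ b) (s : G) :
    IsBarycenter (X := (X : Set E)) (s • ℓ) (s • b) := by
  intro f
  let f_smul : E →L[ℝ] ℝ := ⟨f.toLinearMap ∘ₗ DistribSMul.toLinearMap ℝ E s,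
    f.continuous.comp (continuous_const_smul s)⟩
  have translate_dualRestrict :
      translateFun (X := X) s⁻¹ (dualRestrict (X : Set E) f) = dualRestrict (X : Set E) f_smul := by
    ext x
    exact congrArg (fun y : E => (f y : ℂ)) (congrArg (· • (x : E)) (inv_inv s))
  exact (congrArg ℓ translate_dualRestrict).trans (h f_smul)

variable [T2Space E] [IsTopologicalAddGroup E] [ContinuousSMul ℝ E] [LocallyConvexSpace ℝ E]
  {K Q : Set E} {q : E}

theorem exists_pointMass_mem_closure_orbit {X : SubMulAction G E} [CompactSpace X]
    (hQ : Minimal (IsCompactConvexInvariant G) Q) (hq : q ∈ Q.extremePoints ℝ)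
    (hXQ : (X : Set E) ⊆ Q) {ℓ : C(X, ℂ) → ℂ} (hℓ : ℓ ∈ stateSpace C(X, ℂ)) :
    ∃ x : X, pointMass x ∈ closure (orbit G ℓ) := by
  obtain ⟨b, hbQ, hb⟩ : ∃ b ∈ Q, IsBarycenter (X := (X : Set E)) ℓ b :=
    exists_isBarycenter hQ.prop.isCompact hQ.prop.convex hXQ hℓ
  have closure_subset : closure (orbit G ℓ) ⊆ stateSpace C(X, ℂ) :=
    closure_minimal (Set.range_subset_iff.2 fun s => smul_mem_stateSpace s hℓ) stateSpace.isClosed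
  let Γ : Set ((C(X, ℂ) → ℂ) × E) :=
    (closure (orbit G ℓ) ×ˢ Q) ∩ {p | IsBarycenter (X := (X : Set E)) p.1 p.2}
  have hΓ : IsCompact Γ :=
    ((stateSpace.isCompact.of_isClosed_subset isClosed_closure closure_subset).prod
      hQ.prop.isCompact).inter_right isClosed_setOf_isBarycenter
  have orbit_subset : orbit G b ⊆ Prod.snd '' Γ := by
    rintro _ ⟨s, rfl⟩
    exact ⟨(s • ℓ, s • b), ⟨⟨subset_closure (mem_orbit ℓ s), hQ.prop.smul_mem s b hbQ⟩,
      hb.smul s⟩, rfl⟩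
  obtain ⟨⟨ℓ', _⟩, ⟨⟨hℓ', -⟩, hℓ'q⟩, rfl⟩ := closure_minimal orbit_subset
    (hΓ.image continuous_snd).isClosed (mem_closure_orbit_of_mem_extremePoints hQ hq hbQ)
  obtain ⟨x, -, rfl⟩ := eq_pointMass_of_isBarycenter_extreme (X := (X : Set E)) hQ.prop.isCompact
    hQ.prop.convex hXQ hq (closure_subset hℓ') hℓ'q
  exact ⟨x, hℓ'⟩

theorem isGBoundary_orbitClosure (hQ : Minimal (IsCompactConvexInvariant G) Q)
    (hq : q ∈ Q.extremePoints ℝ) : IsGBoundary G (orbitClosure G q) := by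
  have hXQ : (orbitClosure G q : Set E) ⊆ Q :=
    closure_minimal (hQ.prop.orbit_subset hq.1) hQ.prop.isCompact.isClosed
  have hX : CompactSpace (orbitClosure G q) := isCompact_iff_compactSpace.1
    (hQ.prop.isCompact.of_isClosed_subset isClosed_closure hXQ)
  exact
    { nonempty := ⟨⟨q, subset_closure (mem_orbit_self q)⟩⟩
      compact := hX
      t2 := inferInstance
      minimal := isMinimal_orbitClosure fun y hy =>
        mem_closure_orbit_of_mem_extremePoints hQ hq (hXQ hy)
      stronglyProximal := isStronglyProximal_iff.2 fun ℓ hℓ =>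
        exists_pointMass_mem_closure_orbit hQ hq hXQ hℓ }

theorem IsCompactConvexInvariant.exists_isGBoundary (hK : IsCompactConvexInvariant G K) :
    ∃ X : SubMulAction G E, (X : Set E) ⊆ K ∧ IsGBoundary G X := by
  obtain ⟨Q, hQK, hQ⟩ := hK.exists_minimal
  obtain ⟨q, hq⟩ := hQ.prop.isCompact.extremePoints_nonempty hQ.prop.nonempty
  exact ⟨orbitClosure G q, (closure_minimal (hQ.prop.orbit_subset hq.1)
    hQ.prop.isCompact.isClosed).trans hQK, isGBoundary_orbitClosure hQ hq⟩

end Glasner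

/-! ### Rigidity of boundaries -/

section Rigidity

open scoped Pointwise

variable {G : Type*} [Group G]

section Pullback

variable {X Y : Type*} [TopologicalSpace X] [MulAction G X] [ContinuousConstSMul G X]
  [TopologicalSpace Y] [MulAction G Y] [ContinuousConstSMul G Y]

theorem isUnitalPositiveEquivariant_compStarAlgHom' {p : C(Y, X)}
    (hp : ∀ (s : G) (y : Y), p (s • y) = s • p y) :
    IsUnitalPositiveEquivariant G (ContinuousMap.compStarAlgHom' ℂ ℂ p).toAlgHom.toLinearMap where
  map_one := rfl
  map_nonneg _ hf y := hf (p y)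
  equivariant s f := ContinuousMap.ext fun y => congrArg f (hp s⁻¹ y).symm

theorem isUnitalPositiveEquivariant_id :
    IsUnitalPositiveEquivariant G (LinearMap.id : C(X, ℂ) →ₗ[ℂ] C(X, ℂ)) :=
  ⟨rfl, fun _ hf => hf, fun _ _ => rfl⟩

theorem isInjectiveStarHom_of_surjective {φ : C(X, ℂ) →ₗ[ℂ] C(Y, ℂ)} {p : Y → X}
    (hp : Continuous p) (hp_surj : Function.Surjective p)
    (hφ : ∀ y, pointMass y ∘ φ = pointMass (p y)) : IsInjectiveStarHom φ := by
  have φ_apply (f : C(X, ℂ)) (y : Y) : φ f y = f (p y) := congrFun (hφ y) f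
  refine ⟨fun f g hfg => ContinuousMap.ext fun x => ?_,
    ContinuousMap.compStarAlgHom' ℂ ℂ ⟨p, hp⟩, fun f => ContinuousMap.ext fun y => ?_⟩
  · obtain ⟨y, rfl⟩ := hp_surj x
    rw [← φ_apply, ← φ_apply, hfg]
  · exact (φ_apply f y).symm

theorem IsUnitalPositiveEquivariant.comp_mem_stateSpace {φ : C(X, ℂ) →ₗ[ℂ] C(Y, ℂ)}
    (hφ : IsUnitalPositiveEquivariant G φ) {ℓ : C(Y, ℂ) → ℂ} (hℓ : ℓ ∈ stateSpace C(Y, ℂ)) :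
    ℓ ∘ φ ∈ stateSpace C(X, ℂ) :=
  IsUnitalPositive.precomp_mem_stateSpace ⟨hφ.map_one, hφ.map_nonneg⟩ hℓ

theorem IsUnitalPositiveEquivariant.smul_comp {φ : C(X, ℂ) →ₗ[ℂ] C(Y, ℂ)}
    (hφ : IsUnitalPositiveEquivariant G φ) (s : G) (ℓ : C(Y, ℂ) → ℂ) :
    (s • ℓ) ∘ φ = s • (ℓ ∘ φ) :=
  funext fun f => congrArg ℓ (hφ.equivariant s⁻¹ f).symm

end Pullback

theorem pointMass_eq_of_add_eq {X : Type*} [TopologicalSpace X] {x y z : X}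
    (h : (2⁻¹ : ℝ) • pointMass x + (2⁻¹ : ℝ) • pointMass y = pointMass z) :
    pointMass x = pointMass y := by
  funext f
  have average (g : C(X, ℂ)) : 2⁻¹ * g x + 2⁻¹ * g y = g z := by
    simpa [pointMass] using congrFun h g
  have hsq : (f x - f y) ^ 2 = 0 := by
    have := average (f * f)
    simp only [ContinuousMap.mul_apply] at this
    linear_combination 4 * this - 4 * (2⁻¹ * f x + 2⁻¹ * f y + f z) * average f
  exact sub_eq_zero.1 (pow_eq_zero_iff two_ne_zero |>.1 hsq)

variable {X : Type*} [TopologicalSpace X] [MulAction G X] [ContinuousConstSMul G X]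
  {M : Type*} [TopologicalSpace M] [CompactSpace M] [Nonempty M] [MulAction G M]
  [MulAction.IsMinimal G M]

theorem IsGBoundary.mem_range_pointMass (hX : IsGBoundary G X) {Φ : M → C(X, ℂ) → ℂ}
    (hΦ_cont : Continuous Φ) (hΦ_mem : ∀ m, Φ m ∈ stateSpace C(X, ℂ))
    (hΦ_smul : ∀ (s : G) (m : M), Φ (s • m) = s • Φ m) (m : M) :
    Φ m ∈ Set.range (pointMass : X → C(X, ℂ) → ℂ) := by
  have := hX.compact
  have := hX.t2
  have hrange : IsClosed (Set.range (pointMass : X → C(X, ℂ) → ℂ)) :=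
    (isCompact_range continuous_pointMass).isClosed
  have hinv (s : G) :
      s • (Φ ⁻¹' Set.range pointMass) ⊆ Φ ⁻¹' Set.range (pointMass : X → C(X, ℂ) → ℂ) := by
    rintro _ ⟨m, ⟨x, hx⟩, rfl⟩
    exact ⟨s • x, by rw [hΦ_smul, ← hx, smul_pointMass]⟩
  have hne : (Φ ⁻¹' Set.range (pointMass : X → C(X, ℂ) → ℂ)).Nonempty := by
    obtain ⟨m₀⟩ := ‹Nonempty M›
    obtain ⟨x, hx⟩ := isStronglyProximal_iff.1 hX.stronglyProximal (Φ m₀) (hΦ_mem m₀)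
    have orbit_subset : MulAction.orbit G (Φ m₀) ⊆ Set.range Φ := by
      rintro _ ⟨s, rfl⟩
      exact ⟨s • m₀, hΦ_smul s m₀⟩
    obtain ⟨m₁, hm₁⟩ := closure_minimal orbit_subset (isCompact_range hΦ_cont).isClosed hx
    exact ⟨m₁, x, hm₁.symm⟩
  have huniv := (eq_empty_or_univ_of_smul_invariant_closed G (hrange.preimage hΦ_cont)
    hinv).resolve_left hne.ne_empty
  exact huniv.ge (Set.mem_univ m)

theorem IsGBoundary.exists_eq_pointMass (hX : IsGBoundary G X) {Φ : M → C(X, ℂ) → ℂ}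
    (hΦ_cont : Continuous Φ) (hΦ_mem : ∀ m, Φ m ∈ stateSpace C(X, ℂ))
    (hΦ_smul : ∀ (s : G) (m : M), Φ (s • m) = s • Φ m) :
    ∃ p : M → X, Continuous p ∧ Function.Surjective p ∧
      (∀ (s : G) (m : M), p (s • m) = s • p m) ∧ ∀ m, Φ m = pointMass (p m) := by
  have := hX.compact
  have := hX.t2
  have := hX.minimal
  choose p hp using hX.mem_range_pointMass hΦ_cont hΦ_mem hΦ_smul
  have hp_smul (s : G) (m : M) : p (s • m) = s • p m :=
    pointMass_injective (by rw [hp, hΦ_smul, ← smul_pointMass, hp])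
  have hp_cont : Continuous p :=
    (continuous_pointMass.isClosedEmbedding pointMass_injective).isInducing.continuous_iff.2
      (hΦ_cont.congr fun m => (hp m).symm)
  have hinv (s : G) : s • Set.range p ⊆ Set.range p := by
    rintro _ ⟨_, ⟨m, rfl⟩, rfl⟩
    exact ⟨s • m, hp_smul s m⟩
  have hsurj : Function.Surjective p := Set.range_eq_univ.1
    ((eq_empty_or_univ_of_smul_invariant_closed G (isCompact_range hp_cont).isClosed
      hinv).resolve_left (Set.range_nonempty p).ne_empty)
  exact ⟨p, hp_cont, hsurj, hp_smul, fun m => (hp m).symm⟩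

variable [ContinuousConstSMul G M]

theorem IsGBoundary.exists_pointMass_comp (hX : IsGBoundary G X)
    {φ : C(X, ℂ) →ₗ[ℂ] C(M, ℂ)} (hφ : IsUnitalPositiveEquivariant G φ) :
    ∃ p : M → X, Continuous p ∧ Function.Surjective p ∧
      (∀ (s : G) (m : M), p (s • m) = s • p m) ∧ ∀ m, pointMass m ∘ φ = pointMass (p m) :=
  hX.exists_eq_pointMass (Φ := fun m => pointMass m ∘ φ)
    (continuous_pi fun f => (φ f).continuous)
    (fun m => hφ.comp_mem_stateSpace (pointMass_mem_stateSpace m))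
    fun s m => by rw [← smul_pointMass, hφ.smul_comp]

theorem IsGBoundary.isInjectiveStarHom (hX : IsGBoundary G X)
    {φ : C(X, ℂ) →ₗ[ℂ] C(M, ℂ)} (hφ : IsUnitalPositiveEquivariant G φ) :
    IsInjectiveStarHom φ := by
  obtain ⟨p, hp, hp_surj, -, hφp⟩ := hX.exists_pointMass_comp hφ
  exact isInjectiveStarHom_of_surjective hp hp_surj hφp

theorem IsGBoundary.eq_of_isUnitalPositiveEquivariant (hX : IsGBoundary G X)
    {φ ψ : C(X, ℂ) →ₗ[ℂ] C(M, ℂ)} (hφ : IsUnitalPositiveEquivariant G φ)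
    (hψ : IsUnitalPositiveEquivariant G ψ) : φ = ψ := by
  obtain ⟨p, hp, -, hp_smul, hφp⟩ := hX.exists_pointMass_comp hφ
  obtain ⟨q, hq, -, hq_smul, hψq⟩ := hX.exists_pointMass_comp hψ
  -- The average of the two families of states also consists of point masses, which are extreme.
  obtain ⟨r, -, -, -, hr⟩ := hX.exists_eq_pointMass
    (Φ := fun m => (2⁻¹ : ℝ) • pointMass (p m) + (2⁻¹ : ℝ) • pointMass (q m))
    (((continuous_pointMass.comp hp).const_smul (2⁻¹ : ℝ)).add
      ((continuous_pointMass.comp hq).const_smul (2⁻¹ : ℝ)))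
    (fun m => stateSpace.convex (pointMass_mem_stateSpace _) (pointMass_mem_stateSpace _)
      (by norm_num) (by norm_num) (by norm_num))
    fun s m => by rw [hp_smul, hq_smul, ← smul_pointMass, ← smul_pointMass]; rfl
  ext f m
  calc φ f m = pointMass (p m) f := congrFun (hφp m) f
    _ = pointMass (q m) f := congrFun (pointMass_eq_of_add_eq (hr m)) f
    _ = ψ f m := (congrFun (hψq m) f).symm

end Rigidity

/-! ### Existence of the Furstenberg boundary -/

section StoneCech

variable {G : Type*} [Group G]

/-- The action of `G` by left translations on its Stone-Čech compactification, realized as the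
space of ultrafilters on `G`. -/
abbrev ultrafilterMulAction (G : Type*) [Group G] : MulAction G (Ultrafilter G) where
  smul s := Ultrafilter.map (s * ·)
  one_smul F := by
    change F.map ((1 : G) * ·) = F
    simp only [one_mul]
    exact F.map_id
  mul_smul s t F := by
    change F.map (s * t * ·) = (F.map (t * ·)).map (s * ·)
    rw [Ultrafilter.map_map]
    simp only [Function.comp_def, mul_assoc]

attribute [local instance] ultrafilterMulAction

theorem smul_pure_ultrafilter (s t : G) : s • (pure t : Ultrafilter G) = pure (s * t) :=
  Ultrafilter.map_pure _ _

theorem ultrafilter_continuousConstSMul : ContinuousConstSMul G (Ultrafilter G) where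
  continuous_const_smul s := by
    refine ultrafilterBasis_is_basis.continuous_iff.2 ?_
    rintro _ ⟨S, rfl⟩
    exact ultrafilter_isOpen_basic ((s * ·) ⁻¹' S)

attribute [local instance] ultrafilter_continuousConstSMul

theorem exists_ultrafilter_map {B : Type*} [TopologicalSpace B] [CompactSpace B] [T2Space B]
    [Nonempty B] [MulAction G B] [ContinuousConstSMul G B] :
    ∃ p : C(Ultrafilter G, B), ∀ (s : G) (F : Ultrafilter G), p (s • F) = s • p F := by
  obtain ⟨b⟩ := ‹Nonempty B›
  let p : C(Ultrafilter G, B) :=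
    ⟨Ultrafilter.extend fun t : G => t • b, continuous_ultrafilter_extend _⟩
  have p_pure (t : G) : p (pure t) = t • b := congrFun (ultrafilter_extend_extends _) t
  refine ⟨p, fun s => congrFun (denseRange_pure.equalizer (by fun_prop) (by fun_prop) ?_)⟩
  funext t
  simp only [Function.comp_apply, smul_pure_ultrafilter, p_pure, mul_smul]

attribute [local instance] arrow_continuousConstSMul arrow_smulCommClass
  continuousConstSMul_subMulAction

theorem isCompactConvexInvariant_stateSpace {X : Type*} [TopologicalSpace X] [CompactSpace X]
    [Nonempty X] [MulAction G X] [ContinuousConstSMul G X] :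
    IsCompactConvexInvariant G (stateSpace C(X, ℂ)) where
  nonempty := (‹Nonempty X›).elim fun x => ⟨pointMass x, pointMass_mem_stateSpace x⟩
  isCompact := stateSpace.isCompact
  convex := stateSpace.convex
  smul_mem s _ := smul_mem_stateSpace s

theorem IsGBoundary.exists_map_of_subset_stateSpace
    {Y : SubMulAction G (C(Ultrafilter G, ℂ) → ℂ)} (hY : IsGBoundary G Y)
    (hY_sub : (Y : Set (C(Ultrafilter G, ℂ) → ℂ)) ⊆ stateSpace C(Ultrafilter G, ℂ))
    {B : Type*} [TopologicalSpace B] [MulAction G B] [ContinuousConstSMul G B]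
    (hB : IsGBoundary G B) :
    ∃ f : Y → B, Continuous f ∧ Function.Surjective f ∧ ∀ (s : G) (y : Y), f (s • y) = s • f y := by
  have := hY.nonempty
  have := hY.compact
  have := hY.minimal
  have := hB.nonempty
  have := hB.compact
  have := hB.t2
  obtain ⟨p, hp⟩ := exists_ultrafilter_map (G := G) (B := B)
  have hφ := isUnitalPositiveEquivariant_compStarAlgHom' hp
  obtain ⟨f, hf, hf_surj, hf_smul, -⟩ := hB.exists_eq_pointMass
    (Φ := fun y : Y => y.1 ∘ (ContinuousMap.compStarAlgHom' ℂ ℂ p).toAlgHom.toLinearMap)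
    (continuous_pi fun g => (continuous_apply _).comp continuous_subtype_val)
    (fun y => hφ.comp_mem_stateSpace (hY_sub y.2)) fun s y => hφ.smul_comp s y.1
  exact ⟨f, hf, hf_surj, hf_smul⟩

theorem exists_universal_isGBoundary (G : Type u) [Group G] :
    ∃ (Y : Type u) (_ : TopologicalSpace Y) (_ : MulAction G Y) (_ : ContinuousConstSMul G Y),
      IsGBoundary G Y ∧
      ∀ (B : Type w₁) [TopologicalSpace B] [MulAction G B] [ContinuousConstSMul G B],
        IsGBoundary G B →
        ∃ f : Y → B, Continuous f ∧ Function.Surjective f ∧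
          ∀ (s : G) (y : Y), f (s • y) = s • f y := by
  obtain ⟨Y, hY_sub, hY⟩ :=
    (isCompactConvexInvariant_stateSpace (G := G) (X := Ultrafilter G)).exists_isGBoundary
  exact ⟨Y, _, _, inferInstance, hY, fun B _ _ _ hB => hY.exists_map_of_subset_stateSpace hY_sub hB⟩

theorem exists_isFurstenbergBoundary (G : Type u) [Group G] :
    ∃ (X : Type u) (_ : TopologicalSpace X) (_ : MulAction G X) (_ : ContinuousConstSMul G X),
      IsFurstenbergBoundary G X := by
  obtain ⟨X, _, _, _, hX, hX_universal⟩ := exists_universal_isGBoundary.{u, u} G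
  exact ⟨X, _, _, _, hX, hX_universal⟩

end StoneCech

section FurstenbergBoundary

variable {G : Type u} [Group G] {X : Type v} [TopologicalSpace X] [MulAction G X]
  [ContinuousConstSMul G X]

attribute [local instance] continuousConstSMul_subMulAction

theorem IsFurstenbergBoundary.exists_map (hX : IsFurstenbergBoundary G X) {B : Type w₁}
    [TopologicalSpace B] [MulAction G B] [ContinuousConstSMul G B] (hB : IsGBoundary G B) :
    ∃ f : X → B, Continuous f ∧ Function.Surjective f ∧ ∀ (s : G) (x : X), f (s • x) = s • f x := by
  obtain ⟨Y, _, _, _, hY, hY_universal⟩ := exists_universal_isGBoundary.{u, w₁} G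
  obtain ⟨f, hf, hf_surj, hf_smul⟩ := hX.universal Y hY
  obtain ⟨g, hg, hg_surj, hg_smul⟩ := hY_universal B hB
  exact ⟨g ∘ f, hg.comp hf, hg_surj.comp hf_surj, fun s x => by
    simp only [Function.comp_apply, hf_smul, hg_smul]⟩

theorem IsFurstenbergBoundary.exists_map_compactConvex (hX : IsFurstenbergBoundary G X)
    {E : Type*} [AddCommGroup E] [Module ℝ E] [TopologicalSpace E] [DistribMulAction G E]
    [T2Space E] [IsTopologicalAddGroup E] [ContinuousSMul ℝ E] [SMulCommClass G ℝ E]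
    [ContinuousConstSMul G E] [LocallyConvexSpace ℝ E] {K : Set E}
    (hK : IsCompactConvexInvariant G K) :
    ∃ f : X → E, Continuous f ∧ (∀ x, f x ∈ K) ∧ ∀ (s : G) (x : X), f (s • x) = s • f x := by
  obtain ⟨Y, hYK, hY⟩ := hK.exists_isGBoundary
  obtain ⟨f, hf, -, hf_smul⟩ := hX.exists_map hY
  exact ⟨fun x => f x, continuous_subtype_val.comp hf, fun x => hYK (f x).2, fun s x =>
    congrArg Subtype.val (hf_smul s x)⟩

end FurstenbergBoundary

/-! ### Matrices over algebras of functions and over operator systems -/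

section Matrices

open CStarMatrix
open scoped WithCStarModule InnerProductSpace Matrix

variable {A : Type*} [CStarAlgebra A] [PartialOrder A] [StarOrderedRing A]
  {n κ : Type*} [Fintype n] [Fintype κ]

theorem norm_le_of_inner_self_le_smul_one {E : Type*} [NormedAddCommGroup E] [Module ℂ E]
    [SMul A E] [CStarModule A E] {x : E} {C : ℝ} (hC : 0 ≤ C) (hx : ⟪x, x⟫_A ≤ (C ^ 2) • (1 : A)) :
    ‖x‖ ≤ C := by
  refine (pow_le_pow_iff_left₀ (norm_nonneg x) hC two_ne_zero).1 ?_
  calc ‖x‖ ^ 2 = ‖⟪x, x⟫_A‖ := CStarModule.norm_sq_eq A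
    _ ≤ ‖(C ^ 2) • (1 : A)‖ :=
        CStarAlgebra.norm_le_norm_of_nonneg_of_le CStarModule.inner_self_nonneg hx
    _ ≤ C ^ 2 := by
        rw [norm_smul, Real.norm_of_nonneg (sq_nonneg C)]
        exact mul_le_of_le_one_right (sq_nonneg C) norm_one_le_one

theorem norm_sum_star_mul_mul_le {a c : κ → A} {C : ℝ} (ha : ∑ k, star (a k) * a k = 1)
    (hC : 0 ≤ C) (hc : ∀ k, ‖c k‖ ≤ C) : ‖∑ k, star (a k) * c k * a k‖ ≤ C := by
  let x : C⋆ᵐᵒᵈ(A, κ → A) := (WithCStarModule.equiv A (κ → A)).symm fun k => star (a k)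
  let y : C⋆ᵐᵒᵈ(A, κ → A) := (WithCStarModule.equiv A (κ → A)).symm fun k => star (a k) * c k
  have inner_xx : ⟪x, x⟫_A = 1 := by
    simp only [x, WithCStarModule.pi_inner, WithCStarModule.inner_def,
      WithCStarModule.equiv_symm_pi_apply, star_star, ha]
  have inner_xy : ⟪x, y⟫_A = ∑ k, star (a k) * c k * a k := by
    simp only [x, y, WithCStarModule.pi_inner, WithCStarModule.inner_def,
      WithCStarModule.equiv_symm_pi_apply, star_star]
  have inner_yy : ⟪y, y⟫_A ≤ (C ^ 2) • (1 : A) := by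
    simp only [y, WithCStarModule.pi_inner, WithCStarModule.inner_def,
      WithCStarModule.equiv_symm_pi_apply, star_mul, star_star]
    rw [← ha, Finset.smul_sum]
    refine Finset.sum_le_sum fun k _ => ?_
    calc star (a k) * c k * (star (c k) * a k)
        = star (a k) * (c k * star (c k)) * a k := by simp only [mul_assoc]
      _ ≤ ‖c k * star (c k)‖ • (star (a k) * a k) :=
          CStarAlgebra.star_left_conjugate_le_norm_smul
      _ ≤ (C ^ 2) • (star (a k) * a k) := by
          rw [CStarRing.norm_self_mul_star, ← sq]
          gcongr
          exacts [star_mul_self_nonneg _, hc k]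
  have norm_x : ‖x‖ ≤ 1 :=
    norm_le_of_inner_self_le_smul_one (A := A) zero_le_one (by simp [inner_xx])
  calc ‖∑ k, star (a k) * c k * a k‖ = ‖⟪x, y⟫_A‖ := by rw [inner_xy]
    _ ≤ ‖x‖ * ‖y‖ := CStarModule.norm_inner_le _
    _ ≤ 1 * C := mul_le_mul norm_x (norm_le_of_inner_self_le_smul_one hC inner_yy)
        (norm_nonneg y) zero_le_one
    _ = C := one_mul C

theorem norm_ofMatrix_sum_smul_le {p : κ → A} (hp : ∀ k, 0 ≤ p k)
    (hp_sum : ∑ k, p k = 1) {c : κ → CStarMatrix n n ℂ} {C : ℝ} (hC : 0 ≤ C)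
    (hc : ∀ k, ‖c k‖ ≤ C) : ‖ofMatrix fun i j => ∑ k, c k i j • p k‖ ≤ C := by
  classical
  let a (k : κ) : CStarMatrix n n A := ofMatrix (Matrix.diagonal fun _ => CFC.sqrt (p k))
  let d (k : κ) : CStarMatrix n n A := mapₙₐ (StarAlgHom.ofId ℂ A : ℂ →⋆ₙₐ[ℂ] A) (c k)
  have hd (k : κ) : ‖d k‖ ≤ C := (NonUnitalStarAlgHom.norm_apply_le _ (c k)).trans (hc k)
  have star_a (k : κ) : star (a k) = a k := by
    change (Matrix.diagonal fun _ => CFC.sqrt (p k))ᴴ = Matrix.diagonal fun _ => CFC.sqrt (p k)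
    rw [Matrix.diagonal_conjTranspose]
    exact congrArg _ (funext fun _ => (CFC.sqrt_nonneg (p k)).isSelfAdjoint)
  have conj_entry (k : κ) (N : CStarMatrix n n A) (i j : n) :
      (star (a k) * N * a k) i j = CFC.sqrt (p k) * N i j * CFC.sqrt (p k) := by
    rw [star_a]
    simp [a, mul_apply, Matrix.diagonal_apply]
  have sum_apply (M : κ → CStarMatrix n n A) (i j : n) : (∑ k, M k) i j = ∑ k, M k i j :=
    Matrix.sum_apply i j Finset.univ M
  have conj_smul_entry (k : κ) (z : ℂ) :
      CFC.sqrt (p k) * algebraMap ℂ A z * CFC.sqrt (p k) = z • p k := by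
    rw [← Algebra.commutes, mul_assoc, CFC.sqrt_mul_sqrt_self (p k) (hp k), Algebra.smul_def]
  have ha : ∑ k, star (a k) * a k = 1 := by
    ext i j
    rw [sum_apply, one_apply]
    calc ∑ k, (star (a k) * a k) i j = ∑ k, (star (a k) * (1 : CStarMatrix n n A) * a k) i j := by
          simp only [mul_one]
      _ = ∑ k, (if i = j then (1 : ℂ) else 0) • p k := by
          simp only [conj_entry, one_apply, ← conj_smul_entry, apply_ite (algebraMap ℂ A),
            map_one, map_zero]
      _ = if i = j then 1 else 0 := by rw [← Finset.smul_sum, hp_sum, ite_smul, one_smul, zero_smul]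
  convert! norm_sum_star_mul_mul_le ha hC hd
  ext i j
  rw [sum_apply]
  exact Finset.sum_congr rfl fun k _ =>
    ((conj_entry k (d k) i j).trans (conj_smul_entry k (c k i j))).symm

/-- The identification of matrices of continuous functions with matrix-valued continuous
functions. -/
noncomputable def matrixEval (n X : Type*) [Fintype n] [TopologicalSpace X] :
    CStarMatrix n n C(X, ℂ) →⋆ₙₐ[ℂ] C(X, CStarMatrix n n ℂ) where
  toFun F :=
    { toFun := fun x => F.map (· x)
      continuous_toFun := continuous_pi fun i => continuous_pi fun j => (F i j).continuous }
  map_smul' _ _ := rfl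
  map_zero' := rfl
  map_add' _ _ := rfl
  map_mul' F F' := by
    ext x i j
    change (F * F') i j x = ∑ k, F i k x * F' k j x
    simp only [mul_apply, ContinuousMap.sum_apply, ContinuousMap.mul_apply]
  map_star' _ := rfl

theorem norm_le_of_forall_norm_map_eval_le {X : Type*} [TopologicalSpace X] [CompactSpace X]
    {F : CStarMatrix n n C(X, ℂ)} {C : ℝ} (hC : 0 ≤ C)
    (hF : ∀ x, ‖F.map (· x)‖ ≤ C) : ‖F‖ ≤ C := by
  have injective : Function.Injective (matrixEval n X) := fun F F' h =>
    CStarMatrix.ext fun i j => ContinuousMap.ext fun x => congrFun₂ (DFunLike.congr_fun h x) i j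
  rw [← NonUnitalStarAlgHom.norm_map _ injective]
  exact (ContinuousMap.norm_le _ hC).2 hF

theorem norm_sum_smul_le (N : CStarMatrix n n A) (v w : C⋆ᵐᵒᵈ(ℂ, n → ℂ)) :
    ‖∑ j, ∑ i, (v i * star (w j)) • N i j‖ ≤ ‖N‖ * ‖v‖ * ‖w‖ := by
  let e (u : C⋆ᵐᵒᵈ(ℂ, n → ℂ)) : C⋆ᵐᵒᵈ(A, n → A) :=
    (WithCStarModule.equiv A (n → A)).symm fun i => u i • (1 : A)
  have norm_e (u) : ‖e u‖ ≤ ‖u‖ := by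
    refine norm_le_of_inner_self_le_smul_one (A := A) (norm_nonneg u) (le_of_eq ?_)
    have inner_uu : ⟪u, u⟫_ℂ = (‖u‖ ^ 2 : ℝ) := by
      rw [CStarModule.norm_sq_eq ℂ]
      exact Complex.eq_coe_norm_of_nonneg CStarModule.inner_self_nonneg
    calc ⟪e u, e u⟫_A = ∑ i, (u i * star (u i)) • (1 : A) := by
          simp [e, WithCStarModule.pi_inner, WithCStarModule.inner_def, smul_smul, mul_comm]
      _ = ⟪u, u⟫_ℂ • (1 : A) := (Finset.sum_smul ..).symm
      _ = (‖u‖ ^ 2) • (1 : A) := by rw [inner_uu]; exact Complex.coe_smul _ _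
  have inner_e : ⟪e w, toCLM N (e v)⟫_A = ∑ j, ∑ i, (v i * star (w j)) • N i j := by
    rw [toCLM_apply_eq_sum, WithCStarModule.pi_inner]
    refine Finset.sum_congr rfl fun j _ => ?_
    change (∑ i, (v i • (1 : A)) * N i j) * star (w j • (1 : A)) = _
    simp [Finset.smul_sum, smul_smul, mul_comm]
  calc ‖∑ j, ∑ i, (v i * star (w j)) • N i j‖ = ‖⟪e w, toCLM N (e v)⟫_A‖ := by rw [inner_e]
    _ ≤ ‖e w‖ * ‖toCLM N (e v)‖ := CStarModule.norm_inner_le _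
    _ ≤ ‖w‖ * (‖N‖ * ‖v‖) := by
        rw [norm_def]
        gcongr
        · exact norm_e w
        · exact (ContinuousLinearMap.le_opNorm _ _).trans (by gcongr; exact norm_e v)
    _ = ‖N‖ * ‖v‖ * ‖w‖ := by ring

theorem norm_ofMatrix_map_state_le {T : OperatorSystem A} {ω : T.Space →ₗ[ℂ] ℂ}
    (hω : IsUnitalPositive ω) {m : ℕ} (M : Matrix (Fin m) (Fin m) T.Space) :
    ‖ofMatrix (M.map ω)‖ ≤ ‖T.toCStarMatrix M‖ := by
  refine norm_le_of_forall_inner_le (A := ℂ) (C := ‖T.toCStarMatrix M‖₊) fun v w => ?_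
  have inner_eq : ⟪w, toCLM (ofMatrix (M.map ω)) v⟫_ℂ =
      ω (∑ j, ∑ i, (v i * star (w j)) • M i j) := by
    rw [toCLM_apply_eq_sum, WithCStarModule.pi_inner]
    simp only [map_sum, map_smul]
    refine Finset.sum_congr rfl fun j _ => ?_
    change (∑ i, v i * ω (M i j)) * star (w j) = _
    rw [Finset.sum_mul]
    exact Finset.sum_congr rfl fun i _ => mul_right_comm _ _ _
  rw [inner_eq]
  refine (hω.norm_le _).trans ?_
  change ‖((∑ j, ∑ i, (v i * star (w j)) • M i j : T.Space) : A)‖ ≤ _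
  push_cast
  exact norm_sum_smul_le (T.toCStarMatrix M) v w

/-- By partitions of unity `L` is a pointwise limit of maps `f ↦ ∑ k, f (x k) • p k` with `p k ≥ 0`
and `∑ k, p k = 1`, which are compressions of diagonal maps. -/
theorem IsUnitalPositive.norm_ofMatrix_map_le {X : Type*} [TopologicalSpace X] [CompactSpace X]
    [T2Space X] {L : C(X, ℂ) →ₗ[ℂ] A} (hL : IsUnitalPositive L) (M : Matrix n n C(X, ℂ)) :
    ‖ofMatrix (M.map L)‖ ≤ ‖ofMatrix M‖ := by
  have L_continuous : Continuous L :=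
    map_continuous (PositiveLinearMap.mk₀ L hL.map_nonneg : C(X, ℂ) →ₚ[ℂ] A)
  choose t h h_nonneg h_sum h_approx using fun m : ℕ => exists_partition_of_unity_approx
    (fun ij : n × n => M ij.1 ij.2) (Nat.one_div_pos_of_nat (α := ℝ) (n := m))
  let N (m : ℕ) : CStarMatrix n n A := ofMatrix fun i j => ∑ k : t m, M i j k • L (h m k)
  have norm_N_le (m : ℕ) : ‖N m‖ ≤ ‖ofMatrix M‖ :=
    norm_ofMatrix_sum_smul_le (c := fun k => (ofMatrix M).map (· (k : X)))
      (fun k => hL.map_nonneg _ (h_nonneg m k)) (by rw [← map_sum, h_sum, hL.map_one])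
      (norm_nonneg _) fun k => NonUnitalStarAlgHom.norm_apply_le
        (mapₙₐ (n := n) (ContinuousMap.evalStarAlgHom ℂ ℂ (k : X) : C(X, ℂ) →⋆ₙₐ[ℂ] ℂ)) (ofMatrix M)
  have tendsto_N : Filter.Tendsto N Filter.atTop (nhds (ofMatrix (M.map L))) := by
    refine tendsto_pi_nhds.2 fun i => tendsto_pi_nhds.2 fun j => ?_
    have tendsto_sum :
        Filter.Tendsto (fun m => ∑ k : t m, M i j k • h m k) Filter.atTop (nhds (M i j)) :=
      tendsto_iff_norm_sub_tendsto_zero.2 <| squeeze_zero (fun _ => norm_nonneg _)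
        (fun m => (norm_sub_rev _ _).trans_le (h_approx m (i, j)))
        tendsto_one_div_add_atTop_nhds_zero_nat
    exact ((L_continuous.tendsto _).comp tendsto_sum).congr fun m => by
      simp only [Function.comp_apply, map_sum, map_smul]; rfl
  exact le_of_tendsto tendsto_N.norm (.of_forall norm_N_le)

theorem nonneg_iff_norm_smul_one_sub_le {a : A} (ha : IsSelfAdjoint a) {t : ℝ} (ht : ‖a‖ ≤ t) :
    0 ≤ a ↔ ‖(t : ℂ) • (1 : A) - a‖ ≤ t := by
  lift t to NNReal using (norm_nonneg a).trans ht
  rw [nonneg_iff_isSelfAdjoint_and_quasispectrumRestricts, and_iff_right ha,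
    quasispectrumRestricts_iff_spectrumRestricts, SpectrumRestricts.nnreal_iff_nnnorm ha ht,
    Algebra.algebraMap_eq_smul_one]
  rfl

section IntoFunctions

variable {T : OperatorSystem A} {X : Type*} [TopologicalSpace X] [CompactSpace X]
  {ψ : T.Space →ₗ[ℂ] C(X, ℂ)} {m : ℕ}

omit [StarOrderedRing A] [CompactSpace X] in
theorem IsUnitalPositive.eval (hψ : IsUnitalPositive ψ) (x : X) :
    ∃ ω : T.Space →ₗ[ℂ] ℂ, IsUnitalPositive ω ∧ ∀ y, ω y = ψ y x := by
  obtain ⟨ω, hω, h⟩ := hψ.precomp_mem_stateSpace (pointMass_mem_stateSpace x)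
  exact ⟨ω, hω, congrFun h⟩

theorem IsUnitalPositive.norm_ofMatrix_map_le_toCStarMatrix (hψ : IsUnitalPositive ψ)
    (M : Matrix (Fin m) (Fin m) T.Space) : ‖ofMatrix (M.map ψ)‖ ≤ ‖T.toCStarMatrix M‖ := by
  refine norm_le_of_forall_norm_map_eval_le (norm_nonneg _) fun x => ?_
  obtain ⟨ω, hω, h⟩ := hψ.eval x
  have : (ofMatrix (M.map ψ)).map (· x) = ofMatrix (M.map ω) :=
    CStarMatrix.ext fun i j => (h (M i j)).symm
  exact this ▸ norm_ofMatrix_map_state_le hω M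

theorem IsUnitalPositive.nonneg_ofMatrix_map (hψ : IsUnitalPositive ψ)
    {M : Matrix (Fin m) (Fin m) T.Space} (hM : 0 ≤ T.toCStarMatrix M) :
    0 ≤ ofMatrix (M.map ψ) := by
  have star_M (i j) : star (M j i) = M i j :=
    Subtype.ext (congrFun₂ (IsSelfAdjoint.of_nonneg hM).star_eq i j)
  have isSelfAdjoint_map : IsSelfAdjoint (ofMatrix (M.map ψ)) := by
    ext i j x
    obtain ⟨ω, hω, h⟩ := hψ.eval x
    change star (ψ (M j i) x) = ψ (M i j) x
    rw [← h, ← h, ← hω.map_star, star_M]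
  have norm_sub_le := (nonneg_iff_norm_smul_one_sub_le (.of_nonneg hM) le_rfl).1 hM
  rw [nonneg_iff_norm_smul_one_sub_le isSelfAdjoint_map (hψ.norm_ofMatrix_map_le_toCStarMatrix M)]
  set t : ℂ := (‖T.toCStarMatrix M‖ : ℂ)
  let N : Matrix (Fin m) (Fin m) T.Space := t • 1 - M
  have toCStarMatrix_N : T.toCStarMatrix N = t • 1 - T.toCStarMatrix M := by
    ext i j
    change ((t • (1 : Matrix (Fin m) (Fin m) T.Space) i j - M i j : T.Space) : A) =
      t • (1 : CStarMatrix (Fin m) (Fin m) A) i j - M i j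
    rw [one_apply, Matrix.one_apply]
    split_ifs <;> simp
  have map_N : ofMatrix (N.map ψ) = t • 1 - ofMatrix (M.map ψ) := by
    ext1 i j
    change ψ (t • (1 : Matrix (Fin m) (Fin m) T.Space) i j - M i j) =
      t • (1 : CStarMatrix (Fin m) (Fin m) C(X, ℂ)) i j - ψ (M i j)
    rw [one_apply, Matrix.one_apply, map_sub, map_smul]
    split_ifs <;> simp [hψ.map_one]
  rw [← map_N]
  exact (hψ.norm_ofMatrix_map_le_toCStarMatrix N).trans (toCStarMatrix_N ▸ norm_sub_le)

end IntoFunctions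

end Matrices

namespace OperatorSystem

/-- The embedding of `A` as the algebra of `1 × 1` matrices over `A`, as a *-homomorphism. -/
def oneByOne (A : Type*) [CStarAlgebra A] : A →⋆ₙₐ[ℂ] CStarMatrix (Fin 1) (Fin 1) A where
  toFun a := CStarMatrix.ofMatrix fun _ _ => a
  map_smul' _ _ := rfl
  map_zero' := rfl
  map_add' _ _ := rfl
  map_mul' a b := by
    ext
    exact (Fin.sum_univ_one fun _ => a * b).symm
  map_star' _ := rfl

variable {A B : Type*} [CStarAlgebra A]

theorem oneByOne_one : oneByOne A 1 = 1 := by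
  ext i j
  rw [CStarMatrix.one_apply, if_pos (Subsingleton.elim i j)]
  rfl

variable [PartialOrder A] [StarOrderedRing A] [CStarAlgebra B] [PartialOrder B]
  [StarOrderedRing B] {S : OperatorSystem A} {T : OperatorSystem B} {φ : S.Space →ₗ[ℂ] T.Space}

theorem norm_oneByOne (a : A) : ‖oneByOne A a‖ = ‖a‖ :=
  NonUnitalStarAlgHom.norm_map _ (fun _ _ h => congrFun₂ h 0 0 : Function.Injective (oneByOne A)) a

theorem oneByOne_nonneg_iff {a : A} : 0 ≤ oneByOne A a ↔ 0 ≤ a := by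
  refine ⟨fun h => ?_, map_nonneg (oneByOne A)⟩
  have isSelfAdjoint : IsSelfAdjoint a := congrFun₂ (IsSelfAdjoint.of_nonneg h).star_eq 0 0
  rw [nonneg_iff_norm_smul_one_sub_le isSelfAdjoint le_rfl, ← norm_oneByOne, map_sub, map_smul,
    oneByOne_one]
  exact (nonneg_iff_norm_smul_one_sub_le (.of_nonneg h) (norm_oneByOne a).le).1 h

theorem IsCompletelyPositive.isPositive (hφ : IsCompletelyPositive φ) : IsPositive φ :=
  fun x hx => oneByOne_nonneg_iff.1 (hφ 1 (fun _ _ => x) (oneByOne_nonneg_iff.2 hx))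

theorem IsCompletelyIsometric.norm_map (hφ : IsCompletelyIsometric φ) (x : S.Space) :
    ‖φ x‖ = ‖x‖ :=
  (norm_oneByOne (φ x : B)).symm.trans ((hφ 1 fun _ _ => x).trans (norm_oneByOne (x : A)))

theorem stateSpace_nonempty [Nontrivial A] (S : OperatorSystem A) :
    (stateSpace S.Space).Nonempty := by
  have norm_one : ‖(1 : S.Space)‖ = 1 := CStarRing.norm_one (E := A)
  obtain ⟨ω, hω, -⟩ := exists_state_extension (.toSpanSingleton ℂ S.Space norm_one)
    (one_smul ℂ _) (L := LinearMap.id) ⟨rfl, fun _ hz => hz⟩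
  exact ⟨ω, ω, hω, rfl⟩

end OperatorSystem

/-! ### Extension of maps into `C(X)` -/

theorem exists_isUnitalPositive_of_continuous {V X : Type*} [AddCommGroup V] [Module ℂ V] [One V]
    [PartialOrder V] [TopologicalSpace X] {ω : X → V → ℂ} (hω : Continuous ω)
    (hω_mem : ∀ x, ω x ∈ stateSpace V) :
    ∃ ψ : V →ₗ[ℂ] C(X, ℂ), IsUnitalPositive ψ ∧ ∀ v x, ψ v x = ω x v := by
  choose L hL hLω using hω_mem
  obtain rfl : (fun x => ⇑(L x)) = ω := funext hLω
  let ψ : V →ₗ[ℂ] C(X, ℂ) :=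
    { toFun := fun v => ⟨fun x => L x v, (continuous_apply v).comp hω⟩
      map_add' := fun v w => ContinuousMap.ext fun x => map_add (L x) v w
      map_smul' := fun c v => ContinuousMap.ext fun x => map_smul (L x) c v }
  exact ⟨ψ, ⟨ContinuousMap.ext fun x => (hL x).map_one, fun v hv x => (hL x).map_nonneg v hv⟩,
    fun _ _ => rfl⟩

section Extension

variable {G : Type u} [Group G] {X : Type v} [TopologicalSpace X] [CompactSpace X]
  [MulAction G X] [ContinuousConstSMul G X]

attribute [local instance] arrow_continuousConstSMul arrow_smulCommClass

theorem IsGBoundary.eq_pointMass (hX : IsGBoundary G X) {Φ : X → C(X, ℂ) → ℂ}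
    (hΦ_cont : Continuous Φ) (hΦ_mem : ∀ x, Φ x ∈ stateSpace C(X, ℂ))
    (hΦ_smul : ∀ (s : G) (x : X), Φ (s • x) = s • Φ x) (x : X) : Φ x = pointMass x := by
  have := hX.nonempty
  have := hX.minimal
  obtain ⟨p, hp, -, hp_smul, hΦ⟩ := hX.exists_eq_pointMass hΦ_cont hΦ_mem hΦ_smul
  have pullback_eq_id := hX.eq_of_isUnitalPositiveEquivariant
    (isUnitalPositiveEquivariant_compStarAlgHom' (p := ⟨p, hp⟩) hp_smul)
    isUnitalPositiveEquivariant_id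
  rw [hΦ]
  exact funext fun f => DFunLike.congr_fun (LinearMap.congr_fun pullback_eq_id f) x

/-- `f` is the first component of an equivariant map from `X` into the fibre product of `K` and the
state space of `C(X)` over `F`, whose second component is evaluation by rigidity. -/
theorem IsFurstenbergBoundary.exists_lift (hX : IsFurstenbergBoundary G X)
    {E F : Type*} [AddCommGroup E] [Module ℝ E] [TopologicalSpace E] [DistribMulAction G E]
    [T2Space E] [IsTopologicalAddGroup E] [ContinuousSMul ℝ E] [SMulCommClass G ℝ E]
    [ContinuousConstSMul G E] [LocallyConvexSpace ℝ E] [AddCommGroup F] [Module ℝ F]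
    [TopologicalSpace F] [T2Space F] [SMul G F]
    {r : E →L[ℝ] F} {π : (C(X, ℂ) → ℂ) →L[ℝ] F} (hr : ∀ (s : G) k, r (s • k) = s • r k)
    (hπ : ∀ (s : G) ℓ, π (s • ℓ) = s • π ℓ) {K : Set E} (hK : IsCompact K) (hK_convex : Convex ℝ K)
    (hne : ∃ k ∈ K, ∃ ℓ ∈ stateSpace C(X, ℂ), r k = π ℓ)
    (hsmul : ∀ (s : G), ∀ k ∈ K, ∀ ℓ ∈ stateSpace C(X, ℂ), r k = π ℓ → s • k ∈ K) :
    ∃ f : X → E, Continuous f ∧ (∀ x, f x ∈ K) ∧ (∀ (s : G) (x : X), f (s • x) = s • f x) ∧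
      ∀ x, r (f x) = π (pointMass x) := by
  let P : Set (E × (C(X, ℂ) → ℂ)) := (K ×ˢ stateSpace C(X, ℂ)) ∩ {p | r p.1 = π p.2}
  have hP : IsCompactConvexInvariant G P :=
    { nonempty := by
        obtain ⟨k, hk, ℓ, hℓ, h⟩ := hne
        exact ⟨(k, ℓ), ⟨hk, hℓ⟩, h⟩
      isCompact := (hK.prod stateSpace.isCompact).inter_right
        (isClosed_eq (r.continuous.comp continuous_fst) (π.continuous.comp continuous_snd))
      convex := (hK_convex.prod stateSpace.convex).inter
        (LinearMap.eqLocus (r.toLinearMap ∘ₗ .fst ℝ E _) (π.toLinearMap ∘ₗ .snd ℝ E _)).convex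
      smul_mem := by
        rintro s ⟨k, ℓ⟩ ⟨⟨hk, hℓ⟩, h⟩
        refine ⟨⟨hsmul s k hk ℓ hℓ h, smul_mem_stateSpace s hℓ⟩, ?_⟩
        change r (s • k) = π (s • ℓ)
        rw [hr, hπ, show r k = π ℓ from h] }
  obtain ⟨f, hf, hfP, hf_smul⟩ := hX.exists_map_compactConvex hP
  refine ⟨fun x => (f x).1, hf.fst, fun x => (hfP x).1.1,
    fun s x => congrArg Prod.fst (hf_smul s x), fun x => ?_⟩
  rw [← hX.isGBoundary.eq_pointMass hf.snd (fun x => (hfP x).1.2)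
    (fun s x => congrArg Prod.snd (hf_smul s x))]
  exact (hfP x).2

open OperatorSystem GOperatorSystem

theorem IsFurstenbergBoundary.exists_equivariant_extension (hX : IsFurstenbergBoundary G X)
    {A B : Type*} [CStarAlgebra A] [PartialOrder A] [CStarAlgebra B] [PartialOrder B]
    [StarOrderedRing B] {S : GOperatorSystem G A} {T : GOperatorSystem G B}
    {ι : S.Space →ₗ[ℂ] T.Space} (hι_one : ι 1 = 1) (hι : IsEquivariant ι)
    {ψ : S.Space →ₗ[ℂ] C(X, ℂ)} (hψ_one : ψ 1 = 1)
    (hψ : ∀ s y, ψ (S.act s y) = translateFun s (ψ y))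
    {ω : T.Space → ℂ} (hω : ω ∈ stateSpace T.Space) {ℓ : C(X, ℂ) → ℂ}
    (hℓ : ℓ ∈ stateSpace C(X, ℂ)) (hωℓ : ω ∘ ι = ℓ ∘ ψ) :
    ∃ ψ' : T.Space →ₗ[ℂ] C(X, ℂ), IsUnitalPositive ψ' ∧
      (∀ s y, ψ' (T.act s y) = translateFun s (ψ' y)) ∧ ψ' ∘ₗ ι = ψ := by
  let : MulAction G S.Space := .compHom S.Space S.act
  let : MulAction G T.Space := .compHom T.Space T.act
  let r : (T.Space → ℂ) →L[ℝ] (S.Space → ℂ) := .pi fun y => .proj (ι y)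
  let π : (C(X, ℂ) → ℂ) →L[ℝ] (S.Space → ℂ) := .pi fun y => .proj (ψ y)
  have hr (s : G) (k : T.Space → ℂ) : r (s • k) = s • r k :=
    funext fun y => congrArg k (hι s⁻¹ y).symm
  have hπ (s : G) (ℓ : C(X, ℂ) → ℂ) : π (s • ℓ) = s • π ℓ :=
    funext fun y => congrArg ℓ (hψ s⁻¹ y).symm
  have smul_mem (s : G) : ∀ k ∈ stateSpace T.Space, ∀ ℓ ∈ stateSpace C(X, ℂ), r k = π ℓ →
      s • k ∈ stateSpace T.Space := by
    rintro _ ⟨L, hL, rfl⟩ ℓ hℓ h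
    refine ⟨L ∘ₗ T.act s⁻¹, ⟨?_, fun y hy => hL.map_nonneg _ (T.act_nonneg s⁻¹ y hy)⟩, rfl⟩
    calc L (T.act s⁻¹ 1) = r L (S.act s⁻¹ 1) := by rw [← hι_one, ← hι]; rfl
      _ = ℓ (translateFun s⁻¹ (ψ 1)) := by rw [h, ← hψ]; rfl
      _ = 1 := by rw [hψ_one]; exact stateSpace.map_one hℓ
  obtain ⟨f, hf, hf_mem, hf_smul, hrf⟩ := hX.exists_lift hr hπ stateSpace.isCompact
    stateSpace.convex ⟨ω, hω, ℓ, hℓ, hωℓ⟩ smul_mem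
  obtain ⟨ψ', hψ', hψ'_apply⟩ := exists_isUnitalPositive_of_continuous hf hf_mem
  refine ⟨ψ', hψ', fun s y => ContinuousMap.ext fun x => ?_, LinearMap.ext fun y =>
    ContinuousMap.ext fun x => (hψ'_apply _ x).trans (congrFun (hrf x) y)⟩
  calc ψ' (T.act s y) x = f x (s • y) := hψ'_apply _ x
    _ = (s⁻¹ • f x) y := by rw [arrow_smul_apply, inv_inv]
    _ = ψ' y (s⁻¹ • x) := by rw [← hf_smul, hψ'_apply]

/-- Families of states of `T` indexed by `G` carry the translation action of `G`, so no action on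
`S` or `T` is required; the extension is read off at the index `1`. -/
theorem IsFurstenbergBoundary.exists_extension (hX : IsFurstenbergBoundary G X)
    {A B : Type*} [CStarAlgebra A] [PartialOrder A] [StarOrderedRing A] [CStarAlgebra B]
    [PartialOrder B] [StarOrderedRing B] {S : OperatorSystem A} {T : OperatorSystem B}
    {ι : S.Space →ₗᵢ[ℂ] T.Space} (hι : ι 1 = 1) {ψ : S.Space →ₗ[ℂ] C(X, ℂ)}
    (hψ : IsUnitalPositive ψ) :
    ∃ ψ' : T.Space →ₗ[ℂ] C(X, ℂ), IsUnitalPositive ψ' ∧ ψ' ∘ₗ ι.toLinearMap = ψ := by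
  let r : (G → T.Space → ℂ) →L[ℝ] (G → S.Space → ℂ) := .pi fun g => .pi fun y =>
    (.proj (ι y) : (T.Space → ℂ) →L[ℝ] ℂ).comp (.proj g)
  let π : (C(X, ℂ) → ℂ) →L[ℝ] (G → S.Space → ℂ) := .pi fun g => .pi fun y => .proj (g • ψ y)
  have hπ (s : G) (ℓ : C(X, ℂ) → ℂ) : π (s • ℓ) = s • π ℓ :=
    funext fun g => funext fun y => congrArg ℓ (mul_smul s⁻¹ g (ψ y)).symm
  obtain ⟨x₀⟩ := hX.isGBoundary.nonempty
  choose ev hev hev_apply using hψ.eval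
  choose ω hω hω_apply using fun g : G => exists_state_extension ι hι (hev (g⁻¹ • x₀))
  obtain ⟨f, hf, hf_mem, -, hrf⟩ := hX.exists_lift (G := G) (r := r) (fun _ _ => rfl) hπ
    (isCompact_univ_pi fun _ => stateSpace.isCompact) (convex_pi fun _ _ => stateSpace.convex)
    ⟨fun g => ω g, fun g _ => ⟨ω g, hω g, rfl⟩, pointMass x₀, pointMass_mem_stateSpace x₀,
      funext fun g => funext fun y => (hω_apply g y).trans (hev_apply _ y)⟩
    fun s k hk ℓ _ _ g _ => hk (s⁻¹ * g) trivial
  obtain ⟨ψ', hψ', hψ'_apply⟩ := exists_isUnitalPositive_of_continuous (ω := fun x => f x 1)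
    ((continuous_apply 1).comp hf) fun x => hf_mem x 1 trivial
  refine ⟨ψ', hψ', LinearMap.ext fun y => ContinuousMap.ext fun x => ?_⟩
  calc ψ' (ι y) x = r (f x) 1 y := hψ'_apply _ x
    _ = ((1 : G) • ψ y) x := congrFun₂ (hrf x) 1 y
    _ = ψ y x := by rw [one_smul]

/-- The underlying space of the operator system `C(X)`, identified with `C(X)` itself. -/
noncomputable def ofSpaceEquiv (G X : Type*) [Group G] [TopologicalSpace X] [CompactSpace X]
    [MulAction G X] [ContinuousConstSMul G X] : (ofSpace G X).Space ≃ₗ[ℂ] C(X, ℂ) :=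
  Submodule.topEquiv

theorem IsUnitalPositive.ofSpaceEquiv_comp {A : Type*} [CStarAlgebra A] [PartialOrder A]
    [StarOrderedRing A] {S : OperatorSystem A} {ψ : S.Space →ₗ[ℂ] (ofSpace G X).Space}
    (hψ_one : IsUnital ψ) (hψ : IsCompletelyPositive ψ) :
    IsUnitalPositive ((ofSpaceEquiv G X).toLinearMap ∘ₗ ψ) :=
  ⟨congrArg Subtype.val hψ_one, hψ.isPositive⟩

theorem IsUnitalPositive.isUnital_isCompletelyPositive {A : Type*} [CStarAlgebra A]
    [PartialOrder A] [StarOrderedRing A] {T : OperatorSystem A} {ψ : T.Space →ₗ[ℂ] C(X, ℂ)}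
    (hψ : IsUnitalPositive ψ) :
    IsUnital (T := (ofSpace G X).toOperatorSystem) ((ofSpaceEquiv G X).symm.toLinearMap ∘ₗ ψ) ∧
      IsCompletelyPositive (T := (ofSpace G X).toOperatorSystem)
        ((ofSpaceEquiv G X).symm.toLinearMap ∘ₗ ψ) :=
  ⟨Subtype.ext hψ.map_one, fun _ _ hM => hψ.nonneg_ofMatrix_map hM⟩

theorem IsFurstenbergBoundary.isGInjective (hX : IsFurstenbergBoundary G X) :
    (ofSpace G X).IsGInjective.{u, v, w₁, w₂} := by
  intro A _ _ _ B _ _ _ S T ι ψ hι_one hι_isom hι hψ_one hψ_pos hψ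
  have hψ₀ := IsUnitalPositive.ofSpaceEquiv_comp hψ_one hψ_pos
  obtain ⟨x₀⟩ := hX.isGBoundary.nonempty
  obtain ⟨ev, hev, hev_apply⟩ := hψ₀.eval x₀
  obtain ⟨ω, hω, hω_apply⟩ := exists_state_extension ⟨ι, hι_isom.norm_map⟩ hι_one hev
  obtain ⟨ψ', hψ', hψ'_act, hψ'_ext⟩ := hX.exists_equivariant_extension hι_one hι hψ₀.map_one
    (fun s y => congrArg Subtype.val (hψ s y)) ⟨ω, hω, rfl⟩ (pointMass_mem_stateSpace x₀)
    (funext fun y => (hω_apply y).trans (hev_apply y))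
  obtain ⟨isUnital, isCompletelyPositive⟩ := hψ'.isUnital_isCompletelyPositive (G := G)
  exact ⟨_, isUnital, isCompletelyPositive, fun s y => Subtype.ext (hψ'_act s y),
    LinearMap.ext fun y => Subtype.ext (LinearMap.congr_fun hψ'_ext y)⟩

theorem IsFurstenbergBoundary.isInjective (hX : IsFurstenbergBoundary G X) :
    (ofSpace G X).toOperatorSystem.IsInjective.{v, w₁, w₂} := by
  intro A _ _ _ B _ _ _ S T ι ψ hι_one hι_isom hψ_one hψ_pos
  obtain ⟨ψ', hψ', hψ'_ext⟩ := hX.exists_extension (ι := ⟨ι, hι_isom.norm_map⟩) hι_one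
    (IsUnitalPositive.ofSpaceEquiv_comp hψ_one hψ_pos)
  obtain ⟨isUnital, isCompletelyPositive⟩ := hψ'.isUnital_isCompletelyPositive (G := G)
  exact ⟨_, isUnital, isCompletelyPositive,
    LinearMap.ext fun y => Subtype.ext (LinearMap.congr_fun hψ'_ext y)⟩

theorem IsFurstenbergBoundary.exists_leftInverse (hX : IsFurstenbergBoundary G X) {A : Type*}
    [CStarAlgebra A] [Nontrivial A] [PartialOrder A] [StarOrderedRing A] {S : GOperatorSystem G A}
    {φ : (ofSpace G X).Space →ₗ[ℂ] S.Space} (hφ_one : IsUnital φ) (hφ_pos : IsPositive φ)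
    (hφ : IsEquivariant φ) :
    ∃ ψ : S.Space →ₗ[ℂ] C(X, ℂ), IsUnitalPositive ψ ∧
      ψ ∘ₗ φ = (ofSpaceEquiv G X).toLinearMap := by
  have hφ₀ : IsUnitalPositive (φ ∘ₗ (ofSpaceEquiv G X).symm.toLinearMap) :=
    ⟨hφ_one, fun f hf => hφ_pos _ hf⟩
  obtain ⟨ω, hω⟩ := stateSpace_nonempty S.toOperatorSystem
  obtain ⟨ψ, hψ, -, hψφ⟩ := hX.exists_equivariant_extension hφ_one hφ
    (ψ := (ofSpaceEquiv G X).toLinearMap) rfl (fun _ _ => rfl) hω (hφ₀.precomp_mem_stateSpace hω)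
    rfl
  exact ⟨ψ, hψ, hψφ⟩

theorem IsFurstenbergBoundary.isCompletelyIsometric (hX : IsFurstenbergBoundary G X) {A : Type*}
    [CStarAlgebra A] [Nontrivial A] [PartialOrder A] [StarOrderedRing A] {S : GOperatorSystem G A}
    {φ : (ofSpace G X).Space →ₗ[ℂ] S.Space} (hφ_one : IsUnital φ) (hφ_pos : IsPositive φ)
    (hφ : IsEquivariant φ) : IsCompletelyIsometric φ := by
  have := hX.isGBoundary.t2
  obtain ⟨ψ, hψ, hψφ⟩ := hX.exists_leftInverse hφ_one hφ_pos hφ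
  intro n M
  have hφ₀ : IsUnitalPositive
      (S.toSubmodule.subtype ∘ₗ φ ∘ₗ (ofSpaceEquiv G X).symm.toLinearMap) :=
    ⟨congrArg Subtype.val hφ_one, fun f hf => hφ_pos _ hf⟩
  refine le_antisymm (hφ₀.norm_ofMatrix_map_le (M.map (ofSpaceEquiv G X))) ?_
  calc ‖(ofSpace G X).toCStarMatrix M‖ = ‖CStarMatrix.ofMatrix ((M.map φ).map ψ)‖ := by
        rw [Matrix.map_map, ← LinearMap.coe_comp, hψφ]; rfl
    _ ≤ ‖S.toCStarMatrix (M.map φ)‖ := hψ.norm_ofMatrix_map_le_toCStarMatrix _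

end Extension

theorem mainTheorem9 (G : Type u) [Group G] :
    (∃ (X : Type u) (_ : TopologicalSpace X) (_ : MulAction G X) (_ : ContinuousConstSMul G X),
      IsFurstenbergBoundary G X) ∧
    ∀ (X : Type v) [TopologicalSpace X] [CompactSpace X] [MulAction G X]
      [ContinuousConstSMul G X], IsFurstenbergBoundary G X →
      (GOperatorSystem.ofSpace G X).IsGInjective.{u, v, w₁, w₂} ∧
      (GOperatorSystem.ofSpace G X).toOperatorSystem.IsInjective.{v, w₁, w₂} ∧
      (∀ (A : Type w₃) [CStarAlgebra A] [Nontrivial A] [PartialOrder A] [StarOrderedRing A]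
        (S : GOperatorSystem G A) (φ : (GOperatorSystem.ofSpace G X).Space →ₗ[ℂ] S.Space),
        OperatorSystem.IsUnital φ → OperatorSystem.IsPositive φ →
        GOperatorSystem.IsEquivariant φ → OperatorSystem.IsCompletelyIsometric φ) ∧
      (∀ φ : C(X, ℂ) →ₗ[ℂ] C(X, ℂ), IsUnitalPositiveEquivariant G φ ↔ φ = LinearMap.id) ∧
      (∀ (B : Type w₄) [TopologicalSpace B] [MulAction G B] [ContinuousConstSMul G B],
        IsGBoundary G B →
        (∃! φ : C(B, ℂ) →ₗ[ℂ] C(X, ℂ), IsUnitalPositiveEquivariant G φ) ∧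
        ∀ φ : C(B, ℂ) →ₗ[ℂ] C(X, ℂ), IsUnitalPositiveEquivariant G φ → IsInjectiveStarHom φ) ∧
      (∀ (M : Type w₅) [TopologicalSpace M] [CompactSpace M] [T2Space M] [Nonempty M]
        [MulAction G M] [ContinuousConstSMul G M] [MulAction.IsMinimal G M],
        (∀ φ ψ : C(X, ℂ) →ₗ[ℂ] C(M, ℂ), IsUnitalPositiveEquivariant G φ →
          IsUnitalPositiveEquivariant G ψ → φ = ψ) ∧
        ∀ φ : C(X, ℂ) →ₗ[ℂ] C(M, ℂ), IsUnitalPositiveEquivariant G φ → IsInjectiveStarHom φ) := by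
  refine ⟨exists_isFurstenbergBoundary G, fun X _ _ _ _ hX => ?_⟩
  have hXb := hX.isGBoundary
  have := hXb.nonempty
  have := hXb.minimal
  refine ⟨hX.isGInjective, hX.isInjective, fun _ _ _ _ _ _ _ => hX.isCompletelyIsometric,
    fun φ => ⟨fun hφ => hXb.eq_of_isUnitalPositiveEquivariant hφ isUnitalPositiveEquivariant_id,
      fun h => h ▸ isUnitalPositiveEquivariant_id⟩,
    fun B _ _ _ hB => ?_,
    fun M _ _ _ _ _ _ _ => ⟨fun _ _ => hXb.eq_of_isUnitalPositiveEquivariant,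
      fun _ => hXb.isInjectiveStarHom⟩⟩
  obtain ⟨p, hp, -, hp_smul⟩ := hX.exists_map hB
  have pullback := isUnitalPositiveEquivariant_compStarAlgHom' (p := ⟨p, hp⟩) hp_smul
  exact ⟨⟨_, pullback, fun _ hφ => hB.eq_of_isUnitalPositiveEquivariant hφ pullback⟩,
    fun _ => hB.isInjectiveStarHom⟩
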